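/- Let $q=e^{2\pi i z}$, $f'=\frac1{2\pi i}\frac{df}{dz}$, let $E_2,E_4,E_6$ be the normalised Eisenstein series for $\mathrm{SL}_2(\mathbb Z)$, $\Delta=\frac1{1728}(E_4^3-E_6^2)$ and $j=E_4^3/\Delta$. Put $\omega_0=1$, $\omega_1=E_4^2E_6/\Delta$, $\omega_2=E_4$, $\omega_3=E_6$, $\omega_4=E_4^2$, $\omega_5=E_4E_6$, $\omega_6=\Delta$, $\omega_7=E_4^2E_6$. Let the functions $f_w$ on the upper half-plane ($w\equiv0\pmod 4$, $w\ge8$) be given by $$f_8=E_4^2-2E_2E_6+E_2^2E_4,\qquad f_{12}=\tfrac1{6000}\left(E_6^2-2E_2E_4E_6+E_2^2E_4^2\right),$$ $$f_{16}=\tfrac1{2540160000}\left(-25E_4^4+49E_4E_6^2-48E_2E_4^2E_6+E_2^2(49E_4^3-25E_6^2)\right)$$ and, for $w\ge16$, $w\equiv0\pmod 4$, by the recurrence $$f_{w+4}=\frac{200(w-8)(w-9)(w^2-15w+38)E_4f_w-\frac58(w-8)(w-12)E_4^2f_{w-4}+\Delta f_{w-8}}{16000(w+2)(w-3)(w-5)(w-9)(w-10)(w-11)}.$$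 Then $$f_8=\tfrac{36}5E_4'',\qquad f_{12}=\tfrac1{3000}(E_4^2)''-\tfrac4{25}\Delta,\qquad f_{16}=\tfrac{1}{2751840000}(49E_4^3-25E_6^2)''-\tfrac1{45500}\Delta E_4,$$ and for every $w\equiv0\pmod4$, $w\ge8$, written as $w=12n+2k+4$ with integers $n\ge0$ and $0\le k\le5$ (so $k\in\{0,2,4\}$), the following hold. 1. $f_w$ is a quasimodular form of weight $w$ and depth $2$, that is, $f_w=F_0+E_2F_1+E_2^2F_2$ with holomorphic modular forms $F_\ell$ of weight $w-2\ell$ for $\mathrm{SL}_2(\mathbb Z)$ and $F_2\ne0$. 2. $f=f_w$ satisfies the third-order differential equation $$f'''-\frac w4E_2f''+\left(\frac{w-4}4E_4+\frac{w(w-1)}4E_2'\right)f'-\left(\frac{(w-2)(w-4)}{16}E_4'+\frac{w(w-1)(w-2)}{24}E_2''\right)f=0.$$ 3. There is exactly one triple of polynomials $P,Q,R\in\mathbb C[X]$ with $$f_w=\Delta^n\left(\omega_{k+2}P(j)-2\omega_{k+1}E_2Q(j)+\omega_kE_2^2R(j)\right);$$ the degrees $(\deg P,\deg Q,\deg R)$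 are $(n,n-1,n)$ for $k=0$, $(n,n,n)$ for $k=2$ and $(n+1,n,n)$ for $k=4$. 4. With these polynomials set $g_w=\Delta^n\left(\omega_{k+1}Q(j)-\omega_kE_2R(j)\right)$ and $h_w=\Delta^n\omega_kR(j)$. Then $f_w$, $g_w$ and $h_w$ have the exact orders $q^{w/4-1}$, $q$ and $1$ at $i\infty$; that is, $f_w/q^{w/4-1}$, $g_w/q$ and $h_w$ have finite nonzero limits as $\operatorname{Im}z\to\infty$. -/

import Mathlib

open UpperHalfPlane hiding I
open Filter Topology
open scoped MatrixGroups Polynomial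

namespace QuasimodularRecurrence

noncomputable section

/-- The Eisenstein series `E₂ = 1 - 24 ∑ σ₁(n) qⁿ`. -/
abbrev E2 : ℍ → ℂ := EisensteinSeries.E2

/-- The Eisenstein series `E₄ = 1 + 240 ∑ σ₃(n) qⁿ`. -/
abbrev E4 : ℍ → ℂ := ⇑ModularForm.E₄

/-- The Eisenstein series `E₆ = 1 - 504 ∑ σ₅(n) qⁿ`. -/
abbrev E6 : ℍ → ℂ := ⇑ModularForm.E₆

/-- The modular discriminant `Δ = q ∏ (1 - qⁿ)²⁴ = (E₄³ - E₆²) / 1728`. -/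
abbrev Del : ℍ → ℂ := ModularForm.discriminant

/-- The derivative `f' = (2πi)⁻¹ df/dz = q df/dq`. -/
abbrev dq : (ℍ → ℂ) → ℍ → ℂ := Derivative.normalizedDerivOfComplex

/-- Klein's modular function `j = E₄³ / Δ`. -/
def klein (z : ℍ) : ℂ := E4 z ^ 3 / Del z

/-- The (weakly holomorphic) modular forms `ω_m` of weight `2m`, `m = 0, …, 7`. -/
def omega : ℕ → ℍ → ℂ
  | 0 => 1
  | 1 => E4 ^ 2 * E6 / Del
  | 2 => E4
  | 3 => E6
  | 4 => E4 ^ 2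
  | 5 => E4 * E6
  | 6 => Del
  | 7 => E4 ^ 2 * E6
  | _ => 0

/-- The degree of the polynomial `P` with parameters `n` and `k`, `0 ≤ k ≤ 5`. -/
def degP (n k : ℕ) : ℕ := if k = 4 then n + 1 else n

/-- The degree of `Q`. -/
def degQ (n k : ℕ) : ℕ := if k = 0 then n - 1 else if k = 5 then n + 1 else n

/-- The degree of `R`. -/
def degR (n k : ℕ) : ℕ := if k = 1 then n - 1 else n

/-- `f = Δⁿ (ω_{k+2} P(j) - 2 ω_{k+1} E₂ Q(j) + ω_k E₂² R(j))`, of weight `12n + 2k + 4`. -/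
def fForm (n k : ℕ) (P Q R : ℂ[X]) (z : ℍ) : ℂ :=
  Del z ^ n * (omega (k + 2) z * P.eval (klein z)
    - 2 * omega (k + 1) z * E2 z * Q.eval (klein z)
    + omega k z * E2 z ^ 2 * R.eval (klein z))

/-- `g = Δⁿ (ω_{k+1} Q(j) - ω_k E₂ R(j))`. -/
def gForm (n k : ℕ) (Q R : ℂ[X]) (z : ℍ) : ℂ :=
  Del z ^ n * (omega (k + 1) z * Q.eval (klein z) - omega k z * E2 z * R.eval (klein z))

/-- `h = Δⁿ ω_k R(j)`. -/
def hForm (n k : ℕ) (R : ℂ[X]) (z : ℍ) : ℂ :=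
  Del z ^ n * (omega k z * R.eval (klein z))

/-- `f` is a (holomorphic) quasimodular form of weight `w` and depth `s` for `SL(2, ℤ)`:
`f = ∑_{ℓ ≤ s} E₂^ℓ F_ℓ` with modular forms `F_ℓ` of weight `w - 2ℓ` and `F_s ≠ 0`. -/
def IsQuasimodular (w : ℤ) (s : ℕ) (f : ℍ → ℂ) : Prop :=
  ∃ F : (l : ℕ) → ModularForm 𝒮ℒ (w - 2 * (l : ℤ)), F s ≠ 0 ∧
    ∀ z : ℍ, f z = ∑ l ∈ Finset.range (s + 1), E2 z ^ l * F l z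

/-- `f` has exact order `q^m` at `i∞`: `f / q^m` has a nonzero limit as `Im z → ∞`,
where `q = exp (2πiz)`. -/
def HasExactOrder (f : ℍ → ℂ) (m : ℕ) : Prop :=
  ∃ c : ℂ, c ≠ 0 ∧
    Tendsto (fun z : ℍ => f z / Complex.exp (2 * Real.pi * Complex.I * z) ^ m) atImInfty (𝓝 c)

/-- The differential equation
`f''' - w/4 E₂ f'' + ((w-4)/4 E₄ + w(w-1)/4 E₂') f'
  - ((w-2)(w-4)/16 E₄' + w(w-1)(w-2)/24 E₂'') f = 0`. -/
def SolvesODE (w : ℂ) (f : ℍ → ℂ) : Prop :=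
  ∀ z : ℍ,
    dq (dq (dq f)) z - w / 4 * E2 z * dq (dq f) z
      + ((w - 4) / 4 * E4 z + w * (w - 1) / 4 * dq E2 z) * dq f z
      - ((w - 2) * (w - 4) / 16 * dq E4 z
          + w * (w - 1) * (w - 2) / 24 * dq (dq E2) z) * f z = 0

/-- The sequence `(f_w)`, `w ≡ 0 (mod 4)`, `w ≥ 8`, is given by the initial elements
`f_8`, `f_12`, `f_16` and the three-term recurrence. Indices not of this kind are irrelevant. -/
structure IsRecurrenceSequence (f : ℕ → ℍ → ℂ) : Prop where
  init8 : ∀ z, f 8 z = E4 z ^ 2 - 2 * E2 z * E6 z + E2 z ^ 2 * E4 z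
  init12 : ∀ z, f 12 z =
    1 / 6000 * (E6 z ^ 2 - 2 * E2 z * E4 z * E6 z + E2 z ^ 2 * E4 z ^ 2)
  init16 : ∀ z, f 16 z =
    1 / 2540160000 * (-25 * E4 z ^ 4 + 49 * E4 z * E6 z ^ 2 - 48 * E2 z * E4 z ^ 2 * E6 z
      + E2 z ^ 2 * (49 * E4 z ^ 3 - 25 * E6 z ^ 2))
  recurrence : ∀ w : ℕ, 16 ≤ w → 4 ∣ w → ∀ z, f (w + 4) z =
    1 / (16000 * ((w : ℂ) + 2) * (w - 3) * (w - 5) * (w - 9) * (w - 10) * (w - 11)) *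
      (200 * ((w : ℂ) - 8) * (w - 9) * (w ^ 2 - 15 * w + 38) * E4 z * f w z
        - 5 / 8 * ((w : ℂ) - 8) * (w - 12) * E4 z ^ 2 * f (w - 4) z
        + Del z * f (w - 8) z)

end

end QuasimodularRecurrence

/-!
The equation for `f_w` is, in terms of Serre derivatives, a third-order modular differential
equation of weight `w - 2` with exponents `0`, `1`, `w / 4 - 1` at `i∞`. A second-order operator
raises its solutions from `w` to `w + 4` and another one lowers them from `w + 4` to `w`, up to a
factor `Δ`. The solutions raised from `f₈ = (36 / 5) E₄''` satisfy the three-term recurrence, hence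
are the `f_w`, and each raising step increases the order at `i∞` by one.

The recurrence is linear over functions not involving `E₂`, so the coefficients of `1`, `E₂` and
`E₂²` in `f_w` satisfy it separately; they are therefore modular forms, with nonzero constant terms.
A modular form becomes `Δⁿ ω_k` times a polynomial in `j` by repeatedly subtracting the multiple of
`E₄³ⁿ ω_k` with the same constant term and dividing by `Δ`. The decomposition in powers of `E₂` is
unique because the transformation law of `E₂` turns a relation at one point into a quadratic
equation with at least three roots.
-/

namespace QuasimodularRecurrence

open scoped Manifold ModularForm
open Function.Periodic (qParam)

noncomputable section

/-! ### Raising and lowering operators -/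

/-- A differential algebra with three elements subject to Ramanujan's identities for the
derivatives of `E₂`, `E₄` and `E₆`. -/
structure RamanujanSystem (K A : Type*) [Field K] [CommRing A] [Algebra K A] where
  D : Derivation K A A
  e₂ : A
  e₄ : A
  e₆ : A
  D_e₂ : D e₂ = (1 / 12 : K) • (e₂ ^ 2 - e₄)
  D_e₄ : D e₄ = (1 / 3 : K) • (e₂ * e₄ - e₆)
  D_e₆ : D e₆ = (1 / 2 : K) • (e₂ * e₆ - e₄ ^ 2)

theorem four_mul_add_sub_ne_zero {K : Type*} [Ring K] [CharZero K] (u : ℕ) {a b : ℕ}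
    (h : a % 4 ≠ b % 4) : 4 * (u : K) + a - b ≠ 0 := by
  rw [sub_ne_zero]
  intro h'
  have : 4 * u + a = b := by exact_mod_cast h'
  omega

/-- The product `(w + 2)(w - 3)(w - 5)(w - 10)` common to the normalization of the ladder and the
denominator of the recurrence. -/
def ladderFactor {K : Type*} [Field K] (w : K) : K := (w + 2) * (w - 3) * (w - 5) * (w - 10)

theorem ladderFactor_ne_zero {K : Type*} [Field K] [CharZero K] (u : ℕ) :
    ladderFactor (4 * u + 8 : K) ≠ 0 := by
  refine mul_ne_zero (mul_ne_zero (mul_ne_zero ?_ ?_) ?_) ?_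
  · exact_mod_cast (by omega : 4 * u + 8 + 2 ≠ 0)
  all_goals exact four_mul_add_sub_ne_zero u (by norm_num)

/-- A sequence `x u = f_w`, `w = 4u + 8`, satisfying the three-term recurrence with `e` and `δ` in
the places of `E₄` and `Δ`; the shift `w = 4u + 16` makes `x (u + 3)` the left-hand side. -/
def SatisfiesRecurrence (K : Type*) {A : Type*} [Field K] [CommRing A] [Algebra K A] (e δ : A)
    (x : ℕ → A) : Prop :=
  ∀ u : ℕ, ∀ w : K, w = 4 * u + 16 →
    (16000 * ladderFactor w * (w - 9) * (w - 11)) • x (u + 3) =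
      (200 * (w - 8) * (w - 9) * (w ^ 2 - 15 * w + 38)) • (e * x (u + 2))
        - (5 / 8 * (w - 8) * (w - 12)) • (e ^ 2 * x (u + 1)) + δ * x u

namespace RamanujanSystem
variable {K A : Type*} [Field K] [CommRing A] [Algebra K A] (S : RamanujanSystem K A)

/-- The discriminant `(E₄³ - E₆²) / 1728`. -/
def disc : A := (1 / 1728 : K) • (S.e₄ ^ 3 - S.e₆ ^ 2)

/-- The Serre derivative of weight `k`. -/
def serre (k : K) (f : A) : A := S.D f - (k / 12) • (S.e₂ * f)

/-- The modular differential equation of weight `w - 2` with exponents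
`0`, `1`, `w / 4 - 1` at `i∞`, in terms of Serre derivatives. -/
def SolvesSerreODE (w : K) (f : A) : Prop :=
  S.serre (w + 2) (S.serre w (S.serre (w - 2) f)) =
    ((3 * w ^ 2 - 36 * w + 140) / 144) • (S.e₄ * S.serre (w - 2) f)
      + ((w - 2) * (w - 5) * (w - 14) / 864) • (S.e₆ * f)

/-- The operator taking a solution of the equation with parameter `w` to a solution of the
equation with parameter `w + 4`. The coefficient of `E₄` is the one for which the leading term of
exponent `w / 4 - 1` is annihilated. -/
def raise (w : K) (f : A) : A :=
  S.serre w (S.serre (w - 2) f) - ((w - 5) * (w - 6) / 36) • (S.e₄ * f)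

/-- The operator taking a solution of the equation with parameter `w` to `Δ` times a solution of the
equation with parameter `w - 4`. -/
def lower (w : K) (f : A) : A :=
  S.e₄ * S.serre w (S.serre (w - 2) f) + ((w - 7) / 6) • (S.e₆ * S.serre (w - 2) f)
    + ((w - 2) * (w - 14) / 144) • (S.e₄ ^ 2 * f)

/-- The element `f₈ = (36/5) E₄''` from which the sequence starts. -/
def bottom : A := S.e₄ ^ 2 - (2 : K) • (S.e₂ * S.e₆) + S.e₂ ^ 2 * S.e₄

/-- The sequence `f_w`, `w = 4u + 8`, built by the raising operators. -/
def ladder : ℕ → A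
  | 0 => S.bottom
  | u + 1 => (-3 / (10 * ladderFactor (4 * u + 8 : K))) • S.raise (4 * u + 8) (ladder u)

theorem serre_smul (k c : K) (f : A) : S.serre k (c • f) = c • S.serre k f := by
  simp only [serre, Derivation.map_smul]
  algebra

theorem raise_smul (w c : K) (f : A) : S.raise w (c • f) = c • S.raise w f := by
  simp only [raise, serre_smul]
  algebra

theorem lower_smul (w c : K) (f : A) : S.lower w (c • f) = c • S.lower w f := by
  simp only [lower, serre_smul]
  algebra

variable {S} in
theorem SolvesSerreODE.smul {w : K} {f : A} (c : K) (hf : S.SolvesSerreODE w f) :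
    S.SolvesSerreODE w (c • f) := by
  simp only [SolvesSerreODE, serre_smul] at hf ⊢
  linear_combination (norm := algebra) c • hf

variable [CharZero K]

theorem serre_raise {w : K} {f : A} (hf : S.SolvesSerreODE w f) :
    S.serre (w + 2) (S.raise w f) = ((w + 2) * (w - 10) / 864) •
      ((w - 5) • (S.e₆ * f) - (6 : K) • (S.e₄ * S.serre (w - 2) f)) := by
  simp only [SolvesSerreODE, raise, serre, map_sub, Derivation.map_smul, Derivation.leibniz,
    smul_eq_mul, S.D_e₄] at hf ⊢
  linear_combination (norm := algebra) hf

theorem serre_serre_raise {w : K} {f : A} (hf : S.SolvesSerreODE w f) :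
    S.serre (w + 4) (S.serre (w + 2) (S.raise w f)) = ((w + 2) * (w - 10) / 864) •
      ((w - 3) • (S.e₆ * S.serre (w - 2) f) - (6 : K) • (S.e₄ * S.serre w (S.serre (w - 2) f))
        - ((w - 5) / 2) • (S.e₄ ^ 2 * f)) := by
  rw [S.serre_raise hf]
  simp only [serre, map_sub, Derivation.map_smul, Derivation.leibniz, smul_eq_mul, S.D_e₂,
    S.D_e₄, S.D_e₆]
  algebra

variable {S} in
theorem SolvesSerreODE.raise {w : K} {f : A} (hf : S.SolvesSerreODE w f) :
    S.SolvesSerreODE (w + 4) (S.raise w f) := by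
  have hode := hf
  rw [SolvesSerreODE, show w + 4 - 2 = w + 2 by ring, S.serre_serre_raise hf, S.serre_raise hf]
  simp only [SolvesSerreODE, RamanujanSystem.raise, serre, pow_two, map_sub, Derivation.map_smul,
    Derivation.leibniz, smul_eq_mul, S.D_e₂, S.D_e₄, S.D_e₆] at hode ⊢
  linear_combination (norm := algebra) (-6 * ((w + 2) * (w - 10) / 864)) • (S.e₄ * hode)

theorem lower_raise {w : K} {f : A} (hf : S.SolvesSerreODE w f) :
    S.lower (w + 4) (S.raise w f) = (-(ladderFactor w / 3)) • (S.disc * f) := by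
  rw [lower, show w + 4 - 2 = w + 2 by ring, S.serre_serre_raise hf, S.serre_raise hf]
  simp only [RamanujanSystem.raise, disc, ladderFactor]
  algebra

theorem raise_raise {w : K} {g : A} (hg : S.SolvesSerreODE (w - 4) g) :
    (w - 11) • S.raise w (S.raise (w - 4) g) =
      (-((w - 8) * (w ^ 2 - 15 * w + 38) / 24)) • (S.e₄ * S.raise (w - 4) g)
      - ((w - 2) * (w - 7) * (w - 8) * (w - 12) * (w - 14) / 2304) • (S.e₄ ^ 2 * g)
      + ((w - 2) * (w - 7) * (w - 14) / 144) • S.lower (w - 4) g := by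
  have h := S.serre_serre_raise hg
  rw [show w - 4 + 4 = w by ring, show w - 4 + 2 = w - 2 by ring] at h
  conv_lhs => rw [raise, h]
  simp only [raise, lower]
  algebra

theorem bottom_eq_D_D : S.bottom = (36 / 5 : K) • S.D (S.D S.e₄) := by
  simp only [bottom, map_sub, Derivation.map_smul, Derivation.leibniz, smul_eq_mul, S.D_e₂,
    S.D_e₄, S.D_e₆]
  algebra

theorem serre_serre_bottom : S.serre 8 (S.serre 6 S.bottom) =
    (1 / 6 : K) • (S.e₄ ^ 3 + S.e₆ ^ 2) - (2 / 3 : K) • (S.e₂ * S.e₄ * S.e₆)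
      + (1 / 3 : K) • (S.e₂ ^ 2 * S.e₄ ^ 2) := by
  simp only [bottom, serre, pow_two, map_sub, map_add, Derivation.map_smul, Derivation.leibniz,
    smul_eq_mul, S.D_e₂, S.D_e₄, S.D_e₆]
  algebra

theorem solvesSerreODE_bottom : S.SolvesSerreODE 8 S.bottom := by
  rw [SolvesSerreODE, show (8 : K) - 2 = 6 by norm_num, serre_serre_bottom]
  simp only [bottom, serre, pow_succ, pow_zero, one_mul, map_sub, map_add, Derivation.map_smul,
    Derivation.leibniz, smul_eq_mul, S.D_e₂, S.D_e₄, S.D_e₆]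
  algebra

theorem raise_ladder (u : ℕ) : S.raise (4 * u + 8) (S.ladder u) =
    (-(10 / 3) * ladderFactor (4 * u + 8 : K)) • S.ladder (u + 1) := by
  have h := ladderFactor_ne_zero (K := K) u
  rw [ladder, smul_smul]
  rw [show -(10 / 3) * ladderFactor (4 * u + 8 : K) * (-3 / (10 * ladderFactor (4 * u + 8 : K)))
    = 1 by field_simp, one_smul]

theorem solvesSerreODE_ladder : ∀ u : ℕ, S.SolvesSerreODE (4 * u + 8 : K) (S.ladder u)
  | 0 => by simpa [ladder] using S.solvesSerreODE_bottom
  | u + 1 => by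
    have h := (solvesSerreODE_ladder u).raise.smul (-3 / (10 * ladderFactor (4 * u + 8 : K)))
    rwa [show (4 * u + 8 + 4 : K) = 4 * (u + 1 : ℕ) + 8 by push_cast; ring] at h

theorem lower_ladder (u : ℕ) :
    S.lower (4 * u + 12) (S.ladder (u + 1)) = (1 / 10 : K) • (S.disc * S.ladder u) := by
  have h := ladderFactor_ne_zero (K := K) u
  have hl := S.lower_raise (S.solvesSerreODE_ladder u)
  rw [show (4 * u + 8 + 4 : K) = 4 * u + 12 by ring] at hl
  rw [ladder, lower_smul, hl, smul_smul]
  congr 1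
  field_simp

theorem satisfiesRecurrence_ladder : SatisfiesRecurrence K S.e₄ S.disc S.ladder := by
  rintro u w hw
  have hode := S.solvesSerreODE_ladder (u + 1)
  have hraise₁ := S.raise_ladder (u + 1)
  have hraise₂ := S.raise_ladder (u + 2)
  have hlower := S.lower_ladder u
  rw [show (4 * u + 12 : K) = w - 4 by rw [hw]; ring] at hlower
  rw [show (4 * (u + 1 : ℕ) + 8 : K) = w - 4 by rw [hw]; push_cast; ring] at hode hraise₁
  rw [show (4 * (u + 2 : ℕ) + 8 : K) = w by rw [hw]; push_cast; ring] at hraise₂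
  have h := S.raise_raise hode
  rw [hraise₁, raise_smul, hraise₂, hlower] at h
  have hne : (w - 2) * (w - 7) * (w - 14) ≠ 0 := by
    rw [hw]
    exact mul_ne_zero (mul_ne_zero (four_mul_add_sub_ne_zero u (by norm_num))
      (four_mul_add_sub_ne_zero u (by norm_num))) (four_mul_add_sub_ne_zero u (by norm_num))
  refine smul_right_injective A hne ?_
  simp only [ladderFactor] at h ⊢
  linear_combination (norm := algebra) (1440 : K) • h

theorem ladder_one : S.ladder 1 = (1 / 6000 : K) •
    (S.e₆ ^ 2 - (2 : K) • (S.e₂ * S.e₄ * S.e₆) + S.e₂ ^ 2 * S.e₄ ^ 2) := by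
  have hraise : S.raise 8 S.bottom = (1 / 6 : K) •
      (S.e₆ ^ 2 - (2 : K) • (S.e₂ * S.e₄ * S.e₆) + S.e₂ ^ 2 * S.e₄ ^ 2) := by
    rw [raise, show (8 : K) - 2 = 6 by norm_num, serre_serre_bottom]
    simp only [bottom]
    algebra
  simp only [ladder, Nat.cast_zero, mul_zero, zero_add, hraise, ladderFactor]
  algebra

theorem ladder_two : S.ladder 2 = (1 / 2540160000 : K) •
    ((49 : K) • (S.e₄ * S.e₆ ^ 2) - (25 : K) • S.e₄ ^ 4 - (48 : K) • (S.e₂ * S.e₄ ^ 2 * S.e₆)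
      + S.e₂ ^ 2 * ((49 : K) • S.e₄ ^ 3 - (25 : K) • S.e₆ ^ 2)) := by
  rw [ladder, ladder_one]
  simp only [raise, serre, ladderFactor, pow_two, map_sub, map_add, Derivation.map_smul,
    Derivation.leibniz, smul_eq_mul, S.D_e₂, S.D_e₄, S.D_e₆, Nat.cast_one, mul_one]
  algebra

theorem ladder_one_eq_D_D : S.ladder 1 =
    (1 / 3000 : K) • S.D (S.D (S.e₄ ^ 2)) - (4 / 25 : K) • S.disc := by
  simp only [ladder_one, disc, pow_two, map_sub, map_add, Derivation.map_smul,
    Derivation.leibniz, smul_eq_mul, S.D_e₂, S.D_e₄, S.D_e₆]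
  algebra

theorem ladder_two_eq_D_D : S.ladder 2 =
    (1 / 2751840000 : K) • S.D (S.D ((49 : K) • S.e₄ ^ 3 - (25 : K) • S.e₆ ^ 2))
      - (1 / 45500 : K) • (S.disc * S.e₄) := by
  simp only [ladder_two, disc, pow_succ, pow_zero, one_mul, map_sub, map_add,
    Derivation.map_smul, Derivation.leibniz, smul_eq_mul, S.D_e₂, S.D_e₄, S.D_e₆]
  algebra

variable {S} in
theorem SolvesSerreODE.D_D_D {w : K} {f : A} (hf : S.SolvesSerreODE w f) :
    S.D (S.D (S.D f)) - (w / 4) • (S.e₂ * S.D (S.D f))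
      + (((w - 4) / 4) • S.e₄ + (w * (w - 1) / 4) • S.D S.e₂) * S.D f
      - (((w - 2) * (w - 4) / 16) • S.D S.e₄
          + (w * (w - 1) * (w - 2) / 24) • S.D (S.D S.e₂)) * f = 0 := by
  simp only [SolvesSerreODE, serre, pow_two, map_sub, map_add, Derivation.map_smul,
    Derivation.leibniz, smul_eq_mul, S.D_e₂, S.D_e₄] at hf ⊢
  linear_combination (norm := algebra) hf

end RamanujanSystem

/-! ### Expansions in `q` -/

/-- `f = qᵐ (c + O(q))`, where `q = exp (2πiz)` and the second factor is a holomorphic function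
of `q` on the unit disc. -/
def HasLeadingCoeff (f : ℍ → ℂ) (m : ℕ) (c : ℂ) : Prop :=
  ∃ ψ : ℂ → ℂ, DifferentiableOn ℂ ψ (Metric.ball 0 1) ∧ ψ 0 = c ∧
    ∀ z : ℍ, f z = qParam 1 z ^ m * ψ (qParam 1 z)

theorem qParam_mem_ball (z : ℍ) : qParam 1 z ∈ Metric.ball (0 : ℂ) 1 :=
  mem_ball_zero_iff.2 (Function.Periodic.norm_qParam_lt_one one_pos z.im_pos)

theorem hasDerivAt_comp_qParam {φ : ℂ → ℂ} (hφ : DifferentiableOn ℂ φ (Metric.ball 0 1))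
    {f : ℍ → ℂ} (hf : ∀ z : ℍ, f z = φ (qParam 1 z)) (z : ℍ) :
    HasDerivAt (f ∘ ofComplex)
      (2 * Real.pi * Complex.I * (qParam 1 z * deriv φ (qParam 1 z))) (z : ℂ) := by
  have hq : HasDerivAt (qParam 1) (qParam 1 z * (2 * Real.pi * Complex.I)) z := by
    unfold Function.Periodic.qParam
    simpa using ((hasDerivAt_id (z : ℂ)).const_mul (2 * Real.pi * Complex.I)).cexp
  have hφ' : HasDerivAt φ (deriv φ (qParam 1 z)) (qParam 1 z) :=
    (hφ.differentiableAt (Metric.isOpen_ball.mem_nhds (qParam_mem_ball z))).hasDerivAt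
  have heq : f ∘ ofComplex =ᶠ[𝓝 (z : ℂ)] φ ∘ qParam 1 := by
    filter_upwards [isOpen_upperHalfPlaneSet.mem_nhds z.im_pos] with w hw
    simp [ofComplex_apply_of_im_pos hw, hf]
  refine ((hφ'.comp (z : ℂ) hq).congr_of_eventuallyEq heq).congr_deriv ?_
  ring

theorem dq_comp_qParam {φ : ℂ → ℂ} (hφ : DifferentiableOn ℂ φ (Metric.ball 0 1))
    {f : ℍ → ℂ} (hf : ∀ z : ℍ, f z = φ (qParam 1 z)) (z : ℍ) :
    dq f z = qParam 1 z * deriv φ (qParam 1 z) := by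
  rw [dq, Derivative.normalizedDerivOfComplex, (hasDerivAt_comp_qParam hφ hf z).deriv,
    inv_mul_cancel_left₀ Complex.two_pi_I_ne_zero]

namespace HasLeadingCoeff

variable {f g : ℍ → ℂ} {m n : ℕ} {c d : ℂ}

theorem one : HasLeadingCoeff 1 0 1 :=
  ⟨fun _ => 1, differentiableOn_const _, rfl, fun z => by simp⟩

theorem add (hf : HasLeadingCoeff f m c) (hg : HasLeadingCoeff g m d) :
    HasLeadingCoeff (f + g) m (c + d) := by
  obtain ⟨ψ, hψ, hψ₀, hfψ⟩ := hf
  obtain ⟨φ, hφ, hφ₀, hgφ⟩ := hg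
  exact ⟨ψ + φ, hψ.add hφ, by simp [hψ₀, hφ₀], fun z => by simp [hfψ, hgφ, mul_add]⟩

theorem mul (hf : HasLeadingCoeff f m c) (hg : HasLeadingCoeff g n d) :
    HasLeadingCoeff (f * g) (m + n) (c * d) := by
  obtain ⟨ψ, hψ, hψ₀, hfψ⟩ := hf
  obtain ⟨φ, hφ, hφ₀, hgφ⟩ := hg
  refine ⟨ψ * φ, hψ.mul hφ, by simp [hψ₀, hφ₀], fun z => ?_⟩
  simp only [Pi.mul_apply, hfψ, hgφ]
  ring

theorem mul_left (hg : HasLeadingCoeff g 0 1) (hf : HasLeadingCoeff f m c) :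
    HasLeadingCoeff (g * f) m c := by
  simpa using hg.mul hf

theorem smul (a : ℂ) (hf : HasLeadingCoeff f m c) : HasLeadingCoeff (a • f) m (a * c) := by
  obtain ⟨ψ, hψ, hψ₀, hfψ⟩ := hf
  exact ⟨a • ψ, hψ.const_smul a, by simp [hψ₀], fun z => by simp [hfψ, mul_left_comm]⟩

theorem sub (hf : HasLeadingCoeff f m c) (hg : HasLeadingCoeff g m d) :
    HasLeadingCoeff (f - g) m (c - d) := by
  simpa [sub_eq_add_neg] using hf.add (hg.smul (-1))

theorem pow (hf : HasLeadingCoeff f m c) (k : ℕ) : HasLeadingCoeff (f ^ k) (k * m) (c ^ k) := by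
  induction k with
  | zero => simpa using one
  | succ k ih => simpa only [pow_succ, add_mul, one_mul] using ih.mul hf

theorem of_succ (hf : HasLeadingCoeff f (m + 1) c) : HasLeadingCoeff f m 0 := by
  obtain ⟨ψ, hψ, -, hfψ⟩ := hf
  exact ⟨fun q => q * ψ q, differentiableOn_id.mul hψ, by simp, fun z => by rw [hfψ]; ring⟩

theorem exists_succ (hf : HasLeadingCoeff f m 0) : ∃ d, HasLeadingCoeff f (m + 1) d := by
  obtain ⟨ψ, hψ, hψ₀, hfψ⟩ := hf
  refine ⟨_, dslope ψ 0, (Complex.differentiableOn_dslope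
    (Metric.ball_mem_nhds 0 one_pos)).2 hψ, rfl, fun z => ?_⟩
  have hslope : qParam 1 z * dslope ψ 0 (qParam 1 z) = ψ (qParam 1 z) := by
    simpa [hψ₀] using sub_smul_dslope ψ 0 (qParam 1 z)
  rw [hfψ, pow_succ, mul_assoc, hslope]

theorem tendsto (hf : HasLeadingCoeff f m c) :
    Tendsto (fun z => f z / qParam 1 z ^ m) atImInfty (𝓝 c) := by
  obtain ⟨ψ, hψ, rfl, hfψ⟩ := hf
  have hcont : ContinuousAt ψ 0 :=
    (hψ.differentiableAt (Metric.ball_mem_nhds 0 one_pos)).continuousAt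
  refine (hcont.tendsto.comp (qParam_tendsto_atImInfty one_pos)).congr fun z => ?_
  rw [hfψ, mul_div_cancel_left₀ _ (pow_ne_zero _ (Function.Periodic.qParam_ne_zero _)),
    Function.comp_apply]

theorem eventually_ne_zero (hf : HasLeadingCoeff f m c) (hc : c ≠ 0) :
    ∀ᶠ z in atImInfty, f z ≠ 0 :=
  (hf.tendsto.eventually_ne hc).mono fun _ hz => (div_ne_zero_iff.1 hz).1

theorem unique (hf : HasLeadingCoeff f m c) (hf' : HasLeadingCoeff f m d) : c = d :=
  tendsto_nhds_unique hf.tendsto hf'.tendsto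

theorem ne_zero (hf : HasLeadingCoeff f m c) (hc : c ≠ 0) : f ≠ 0 := by
  rintro rfl
  exact hc (hf.unique (by simpa using hf.smul 0))

theorem hasExactOrder (hf : HasLeadingCoeff f m c) (hc : c ≠ 0) : HasExactOrder f m :=
  ⟨c, hc, by simpa [Function.Periodic.qParam] using hf.tendsto⟩

theorem isBoundedAtImInfty (hf : HasLeadingCoeff f 0 c) : IsBoundedAtImInfty f :=
  Tendsto.isBigO_one ℝ (by simpa using hf.tendsto)

theorem mdifferentiable (hf : HasLeadingCoeff f m c) : MDiff f := fun z => by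
  obtain ⟨ψ, hψ, -, hfψ⟩ := hf
  exact mdifferentiableAt_iff.2
    (hasDerivAt_comp_qParam ((differentiableOn_id.pow m).mul hψ) hfψ z).differentiableAt

theorem dq (hf : HasLeadingCoeff f m c) : HasLeadingCoeff (dq f) m (m * c) := by
  obtain ⟨ψ, hψ, rfl, hfψ⟩ := hf
  refine ⟨fun q => m * ψ q + q * deriv ψ q,
    (hψ.const_mul _).add (differentiableOn_id.mul (hψ.deriv Metric.isOpen_ball)),
    by simp, fun z => ?_⟩
  have hderiv : HasDerivAt (fun q => q ^ m * ψ q)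
      (m * qParam 1 z ^ (m - 1) * ψ (qParam 1 z) + qParam 1 z ^ m * deriv ψ (qParam 1 z))
      (qParam 1 z) :=
    (hasDerivAt_pow m _).mul
      (hψ.differentiableAt (Metric.isOpen_ball.mem_nhds (qParam_mem_ball z))).hasDerivAt
  rw [dq_comp_qParam ((differentiableOn_id.pow m).mul hψ) hfψ z]
  refine (congrArg _ hderiv.deriv).trans ?_
  rcases m with _ | m
  · simp
  · rw [Nat.add_sub_cancel]
    ring

end HasLeadingCoeff

theorem exists_eq_comp_qParam_of_hasSum {f : ℍ → ℂ} {a : ℕ → ℂ}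
    (hf : ∀ z : ℍ, HasSum (fun n => a n • qParam 1 z ^ n) (f z)) :
    ∃ ψ : ℂ → ℂ, DifferentiableOn ℂ ψ (Metric.ball 0 1) ∧ ψ 0 = a 0 ∧ deriv ψ 0 = a 1 ∧
      ∀ z : ℍ, f z = ψ (qParam 1 z) := by
  set p : FormalMultilinearSeries ℂ ℂ ℂ := .ofScalars ℂ a
  have hsum (z : ℍ) : p.sum (qParam 1 z) = f z := by
    rw [← (hf z).tsum_eq]
    simp [p, FormalMultilinearSeries.sum, mul_comm]
  have hradius : 1 ≤ p.radius := by
    refine le_of_forall_lt_imp_le_of_dense fun r hr => ?_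
    lift r to NNReal using hr.ne_top
    rcases eq_or_ne r 0 with rfl | hr₀
    · simp
    have hr₁ : ‖(r : ℂ)‖ < 1 := by simpa using hr
    have hr₀' : (r : ℂ) ≠ 0 := mod_cast hr₀
    have hs := (hf ⟨_, Function.Periodic.im_invQParam_pos_of_norm_lt_one one_pos hr₁ hr₀'⟩).summable
    rw [coe_mk, Function.Periodic.qParam_right_inv one_ne_zero hr₀'] at hs
    refine p.le_radius_of_summable ?_
    simpa [p] using hs.norm
  have hp := (p.hasFPowerSeriesOnBall (one_pos.trans_le hradius)).mono one_pos hradius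
  refine ⟨p.sum, ?_, ?_, ?_, fun z => (hsum z).symm⟩
  · simpa [← ENNReal.coe_one, Metric.eball_coe] using hp.differentiableOn
  · simpa [p] using (hp.hasFPowerSeriesAt.coeff_zero ![]).symm
  · simpa [p] using hp.hasFPowerSeriesAt.deriv

/-! ### Modular forms of level one and Ramanujan's identities -/

theorem hasLeadingCoeff_of_hasSum {f : ℍ → ℂ} {a : ℕ → ℂ}
    (hf : ∀ z : ℍ, HasSum (fun n => a n • qParam 1 z ^ n) (f z)) : HasLeadingCoeff f 0 (a 0) := by
  obtain ⟨ψ, hψ, hψ₀, -, hfψ⟩ := exists_eq_comp_qParam_of_hasSum hf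
  exact ⟨ψ, hψ, hψ₀, by simpa using hfψ⟩

theorem hasLeadingCoeff_dq_of_hasSum {f : ℍ → ℂ} {a : ℕ → ℂ}
    (hf : ∀ z : ℍ, HasSum (fun n => a n • qParam 1 z ^ n) (f z)) :
    HasLeadingCoeff (dq f) 1 (a 1) := by
  obtain ⟨ψ, hψ, -, hψ₁, hfψ⟩ := exists_eq_comp_qParam_of_hasSum hf
  exact ⟨deriv ψ, hψ.deriv Metric.isOpen_ball, hψ₁, by simpa using dq_comp_qParam hψ hfψ⟩

theorem hasSum_qExpansion_levelOne {k : ℤ} (F : ModularForm 𝒮ℒ k) (z : ℍ) :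
    HasSum (fun n => (qExpansion 1 F).coeff n • qParam 1 z ^ n) (F z) :=
  UpperHalfPlane.hasSum_qExpansion one_pos
    (SlashInvariantFormClass.periodic_comp_ofComplex F one_mem_strictPeriods_SL)
    (ModularFormClass.holo F) (ModularFormClass.bdd_at_infty F) z

theorem hasLeadingCoeff_E4 : HasLeadingCoeff E4 0 1 := by
  simpa only [EisensteinSeries.E_qExpansion_coeff_zero _ ⟨2, rfl⟩] using
    hasLeadingCoeff_of_hasSum (hasSum_qExpansion_levelOne ModularForm.E₄)

theorem hasLeadingCoeff_E4_pow (k : ℕ) : HasLeadingCoeff (E4 ^ k) 0 1 := by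
  simpa using hasLeadingCoeff_E4.pow k

theorem hasLeadingCoeff_E6 : HasLeadingCoeff E6 0 1 := by
  simpa only [EisensteinSeries.E_qExpansion_coeff_zero _ ⟨3, rfl⟩] using
    hasLeadingCoeff_of_hasSum (hasSum_qExpansion_levelOne ModularForm.E₆)

theorem hasLeadingCoeff_E2 : HasLeadingCoeff E2 0 1 := by
  refine hasLeadingCoeff_of_hasSum
    (a := fun n => if n = 0 then 1 else -24 * (ArithmeticFunction.sigma 1 n : ℂ)) fun z => ?_
  simpa only [Function.Periodic.qParam, Complex.ofReal_one, div_one] using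
    EisensteinSeries.hasSum_qExpansion_E2 (z := z)

theorem hasLeadingCoeff_dq_E4 : HasLeadingCoeff (dq E4) 1 240 := by
  simpa only [ModularForm.E₄_qExpansion_coeff_one] using
    hasLeadingCoeff_dq_of_hasSum (hasSum_qExpansion_levelOne ModularForm.E₄)

theorem hasLeadingCoeff_dq_E6 : HasLeadingCoeff (dq E6) 1 (-504) := by
  simpa only [ModularForm.E₆_qExpansion_coeff_one] using
    hasLeadingCoeff_dq_of_hasSum (hasSum_qExpansion_levelOne ModularForm.E₆)

theorem hasLeadingCoeff_Del : HasLeadingCoeff Del 1 1 := by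
  refine ⟨fun q => ∏' i : ℕ, (1 - q ^ (i + 1)) ^ 24,
    ModularForm.differentiableOn_tprod_one_sub_pow_pow 24, by simp, fun z => ?_⟩
  have hcusp : cuspFunction 1 Del (qParam 1 z) = Del z :=
    SlashInvariantFormClass.eq_cuspFunction CuspForm.discriminant z one_mem_strictPeriods_SL
      one_ne_zero
  rw [pow_one, ← hcusp, ModularForm.discriminant_cuspFunction_eqOn (qParam_mem_ball z)]

theorem Del_eq : Del = (1 / 1728 : ℂ) • (E4 ^ 3 - E6 ^ 2) := by
  ext z
  simp [ModularForm.discriminant_eq_E₄_cube_sub_E₆_sq, div_eq_inv_mul]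

/-- `f` is the underlying function of a modular form of weight `k` and level one. -/
def IsModular (k : ℤ) (f : ℍ → ℂ) : Prop := ∃ F : ModularForm 𝒮ℒ k, ⇑F = f

namespace IsModular

variable {k l : ℤ} {f g : ℍ → ℂ}

theorem add (hf : IsModular k f) (hg : IsModular k g) : IsModular k (f + g) := by
  obtain ⟨F, rfl⟩ := hf
  obtain ⟨G, rfl⟩ := hg
  exact ⟨F + G, rfl⟩

theorem smul (a : ℂ) (hf : IsModular k f) : IsModular k (a • f) := by
  obtain ⟨F, rfl⟩ := hf
  exact ⟨a • F, rfl⟩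

theorem sub (hf : IsModular k f) (hg : IsModular k g) : IsModular k (f - g) := by
  obtain ⟨F, rfl⟩ := hf
  obtain ⟨G, rfl⟩ := hg
  exact ⟨F - G, rfl⟩

theorem mul (hf : IsModular k f) (hg : IsModular l g) : IsModular (k + l) (f * g) := by
  obtain ⟨F, rfl⟩ := hf
  obtain ⟨G, rfl⟩ := hg
  exact ⟨F.mul G, rfl⟩

theorem one : IsModular 0 1 := ⟨1, rfl⟩

theorem pow (hf : IsModular k f) (n : ℕ) : IsModular (n * k) (f ^ n) := by
  induction n with
  | zero => simpa using one
  | succ n ih => simpa only [pow_succ, Nat.cast_succ, add_mul, one_mul] using ih.mul hf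

theorem E4 : IsModular 4 E4 := ⟨ModularForm.E₄, rfl⟩

theorem E6 : IsModular 6 E6 := ⟨ModularForm.E₆, rfl⟩

theorem Del : IsModular 12 Del := ⟨(CuspForm.discriminant : ModularForm 𝒮ℒ 12), rfl⟩

theorem of_slash_eq (hf : MDiff f) (hslash : ∀ γ : SL(2, ℤ), f ∣[k] γ = f)
    (hb : IsBoundedAtImInfty f) : IsModular k f :=
  ⟨{ toFun := f
     slash_action_eq' := fun _ ⟨γ, hγ⟩ => hγ ▸ hslash γ
     holo' := hf
     bdd_at_cusps' := fun {c} hc => by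
       rw [Subgroup.IsArithmetic.isCusp_iff_isCusp_SL2Z] at hc
       rw [OnePoint.isBoundedAt_iff_forall_SL2Z hc]
       exact fun γ _ => (hslash γ).symm ▸ hb }, rfl⟩

theorem slash_eq (hf : IsModular k f) (γ : SL(2, ℤ)) : f ∣[k] γ = f := by
  obtain ⟨F, rfl⟩ := hf
  exact SlashInvariantFormClass.slash_action_eq F _ ⟨γ, rfl⟩

theorem exists_hasLeadingCoeff (hf : IsModular k f) : ∃ c, HasLeadingCoeff f 0 c := by
  obtain ⟨F, rfl⟩ := hf
  exact ⟨_, hasLeadingCoeff_of_hasSum (hasSum_qExpansion_levelOne F)⟩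

theorem eq_zero_of_neg (hf : IsModular k f) (hk : k < 0) : f = 0 := by
  obtain ⟨F, rfl⟩ := hf
  exact ModularFormClass.levelOne_neg_weight_eq_zero hk F

theorem eq_zero_of_weight_two (hf : IsModular 2 f) : f = 0 := by
  obtain ⟨F, rfl⟩ := hf
  rw [rank_zero_iff_forall_zero.1 ModularForm.levelOne_weight_two_rank_zero F,
    FunLike.coe_zero]

theorem exists_eq_Del_mul (hf : IsModular k f) (h : HasLeadingCoeff f 0 0) :
    ∃ g, IsModular (k - 12) g ∧ f = QuasimodularRecurrence.Del * g := by
  obtain ⟨F, rfl⟩ := hf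
  have hcoeff : (qExpansion 1 F).coeff 0 = 0 :=
    (hasLeadingCoeff_of_hasSum (hasSum_qExpansion_levelOne F)).unique h
  obtain ⟨G, rfl⟩ := (ModularForm.isCuspForm_iff_coeffZero_eq_zero F).2 hcoeff
  exact ⟨_, ⟨CuspForm.discriminantEquiv G, rfl⟩,
    (ModularForm.discriminant_mul_discriminantEquiv G).symm⟩

theorem eq_zero (hf : IsModular k f) (hk : k < 12) (h : HasLeadingCoeff f 0 0) : f = 0 := by
  obtain ⟨g, hg, rfl⟩ := hf.exists_eq_Del_mul h
  rw [hg.eq_zero_of_neg (by omega), mul_zero]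

end IsModular

theorem HasLeadingCoeff.serreDerivative {f : ℍ → ℂ} {m : ℕ} {c : ℂ} (hf : HasLeadingCoeff f m c)
    (k : ℂ) : HasLeadingCoeff (Derivative.serreDerivative k f) m ((m - k / 12) * c) := by
  convert hf.dq.sub ((hasLeadingCoeff_E2.mul_left hf).smul (k / 12)) using 1
  · ext z
    simp [div_eq_mul_inv, mul_assoc]
  · ring

theorem IsModular.serreDerivative {k : ℤ} {f : ℍ → ℂ} (hf : IsModular k f) :
    IsModular (k + 2) (Derivative.serreDerivative k f) := by
  obtain ⟨c, hc⟩ := hf.exists_hasLeadingCoeff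
  have h := hc.serreDerivative k
  exact .of_slash_eq h.mdifferentiable (fun γ => Derivative.serreDerivative_slash_invariant
    hc.mdifferentiable (hf.slash_eq γ)) h.isBoundedAtImInfty

theorem E2_slash_apply (γ : SL(2, ℤ)) (z : ℍ) :
    (E2 ∣[(2 : ℤ)] γ) z = E2 z + 12 / (2 * Real.pi * Complex.I) * (γ 1 0 / denom γ z) := by
  rw [EisensteinSeries.E2_slash_action]
  simp only [Pi.sub_apply, Pi.smul_apply, EisensteinSeries.D2, riemannZeta_two, smul_eq_mul]
  have hpi : (Real.pi : ℂ) ≠ 0 := by exact_mod_cast Real.pi_ne_zero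
  have hdenom := denom_ne_zero γ z
  field_simp
  linear_combination (-12 * (γ 1 0 : ℂ)) * Complex.I_sq

theorem hasDerivAt_div_denom (γ : SL(2, ℤ)) (z : ℍ) :
    HasDerivAt ((fun z : ℍ => (γ 1 0 : ℂ) / denom γ z) ∘ ofComplex)
      (-((γ 1 0 : ℂ) / denom γ z) ^ 2) (z : ℂ) := by
  have heq : ((fun z : ℍ => (γ 1 0 : ℂ) / denom γ z) ∘ ofComplex) =ᶠ[𝓝 (z : ℂ)]
      fun w => (γ 1 0 : ℂ) * denom (γ : GL (Fin 2) ℝ) w ^ (-1 : ℤ) := by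
    filter_upwards [isOpen_upperHalfPlaneSet.mem_nhds z.im_pos] with w hw
    simp [ofComplex_apply_of_im_pos hw, div_eq_mul_inv]
  have hzpow := (hasDerivAt_denom_zpow (γ : GL (Fin 2) ℝ) (-1) z).const_mul (γ 1 0 : ℂ)
  refine (hzpow.congr_of_eventuallyEq heq).congr_deriv ?_
  have hdenom := denom_ne_zero γ z
  simp only [Int.reduceNeg, Int.reduceSub, Int.cast_neg, Int.cast_one, zpow_neg, zpow_ofNat,
    Matrix.SpecialLinearGroup.coe_GL_coe_matrix, Matrix.SpecialLinearGroup.map_apply_coe,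
    RingHom.mapMatrix_apply, Int.coe_castRingHom, Matrix.map_apply, Complex.ofReal_intCast]
  field_simp

theorem dq_E2_slash_apply (γ : SL(2, ℤ)) (z : ℍ) :
    (dq E2 ∣[(4 : ℤ)] γ) z = dq E2 z
      + 2 / (2 * Real.pi * Complex.I) * (γ 1 0 / denom γ z) * E2 z
      + 12 / (2 * Real.pi * Complex.I) ^ 2 * (γ 1 0 / denom γ z) ^ 2 := by
  have hE2 : MDiff E2 := E2_mdifferentiable
  have hslash : dq (E2 ∣[(2 : ℤ)] γ) z = dq E2 z -
      12 / (2 * Real.pi * Complex.I) ^ 2 * (γ 1 0 / denom γ z) ^ 2 := by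
    have hderiv := (mdifferentiableAt_iff.1 (hE2 z)).hasDerivAt.add
      ((hasDerivAt_div_denom γ z).const_mul (12 / (2 * Real.pi * Complex.I)))
    rw [funext (E2_slash_apply γ)]
    refine (congrArg ((2 * Real.pi * Complex.I)⁻¹ * ·) hderiv.deriv).trans ?_
    simp only [dq, Derivative.normalizedDerivOfComplex]
    field_simp
    ring
  have hcomm := hslash.symm.trans
    (congrFun (Derivative.normalizedDerivOfComplex_SL_slash (k := 2) hE2 (γ := γ)) z)
  simp only [Pi.sub_apply, E2_slash_apply, Int.reduceAdd, Int.cast_ofNat] at hcomm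
  linear_combination -hcomm

theorem isModular_dq_E2_sub : IsModular 4 ((12 : ℂ) • dq E2 - E2 ^ 2) := by
  have hlead := (hasLeadingCoeff_E2.dq.smul 12).sub (hasLeadingCoeff_E2.pow 2)
  refine .of_slash_eq hlead.mdifferentiable (fun γ => ?_) hlead.isBoundedAtImInfty
  ext z
  have hdq := dq_E2_slash_apply γ z
  have hE2 := E2_slash_apply γ z
  have hdenom : denom γ z ^ (-4 : ℤ) = (denom γ z ^ (-2 : ℤ)) ^ 2 := by
    rw [← zpow_natCast, ← zpow_mul]
    rfl
  rw [ModularForm.SL_slash_apply, hdenom] at hdq ⊢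
  rw [ModularForm.SL_slash_apply] at hE2
  simp only [Pi.sub_apply, Pi.smul_apply, Pi.pow_apply, smul_eq_mul]
  linear_combination 12 * hdq - (E2 (γ • z) * denom γ z ^ (-2 : ℤ) + E2 z
    + 12 / (2 * Real.pi * Complex.I) * (γ 1 0 / denom γ z)) * hE2

theorem dq_E2 : dq E2 = (1 / 12 : ℂ) • (E2 ^ 2 - E4) := by
  have hlead := ((hasLeadingCoeff_E2.dq.smul 12).sub (hasLeadingCoeff_E2.pow 2)).add
    hasLeadingCoeff_E4
  have hzero := (isModular_dq_E2_sub.add .E4).eq_zero (by norm_num)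
    (by simpa using hlead)
  linear_combination (norm := module) (1 / 12 : ℂ) • hzero

theorem dq_eq_serreDerivative_add (k : ℂ) (f : ℍ → ℂ) :
    dq f = Derivative.serreDerivative k f + (k / 12) • (E2 * f) := by
  ext z
  simp [div_eq_mul_inv, mul_assoc]

theorem dq_E4 : dq E4 = (1 / 3 : ℂ) • (E2 * E4 - E6) := by
  have hlead := (hasLeadingCoeff_E4.serreDerivative 4).add (hasLeadingCoeff_E6.smul (1 / 3))
  have hzero := (IsModular.E4.serreDerivative.add (IsModular.E6.smul (1 / 3))).eq_zero
    (by norm_num) (by convert hlead using 1 <;> norm_num)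
  rw [dq_eq_serreDerivative_add 4]
  linear_combination (norm := module) hzero

theorem dq_E6 : dq E6 = (1 / 2 : ℂ) • (E2 * E6 - E4 ^ 2) := by
  have hlead := (hasLeadingCoeff_E6.serreDerivative 6).add
    ((hasLeadingCoeff_E4.pow 2).smul (1 / 2))
  have hzero := (IsModular.E6.serreDerivative.add ((IsModular.E4.pow 2).smul (1 / 2))).eq_zero
    (by norm_num) (by convert hlead using 1 <;> norm_num)
  rw [dq_eq_serreDerivative_add 6]
  linear_combination (norm := module) hzero

/-! ### The recurrence -/

namespace SatisfiesRecurrence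

variable {K A B : Type*} [Field K] [CommRing A] [Algebra K A] [CommRing B] [Algebra K B]
  {e δ : A} {x y : ℕ → A}

theorem map (φ : A →ₐ[K] B) (hx : SatisfiesRecurrence K e δ x) :
    SatisfiesRecurrence K (φ e) (φ δ) (φ ∘ x) := fun u w hw => by
  simpa only [Function.comp_apply, map_smul, map_add, map_sub, map_mul, map_pow] using
    congrArg φ (hx u w hw)

theorem add (hx : SatisfiesRecurrence K e δ x) (hy : SatisfiesRecurrence K e δ y) :
    SatisfiesRecurrence K e δ (x + y) := fun u w hw => by
  simp only [Pi.add_apply]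
  linear_combination (norm := algebra) hx u w hw + hy u w hw

theorem mul_left (a : A) (hx : SatisfiesRecurrence K e δ x) :
    SatisfiesRecurrence K e δ fun u => a * x u := fun u w hw => by
  linear_combination (norm := algebra) a * hx u w hw

variable [CharZero K]

theorem leadingFactor_ne_zero {u : ℕ} {w : K} (hw : w = 4 * u + 16) :
    16000 * ladderFactor w * (w - 9) * (w - 11) ≠ 0 := by
  have hfactor := ladderFactor_ne_zero (K := K) (u + 2)
  rw [show (4 * (u + 2 : ℕ) + 8 : K) = w by rw [hw]; push_cast; ring] at hfactor
  have h9 := four_mul_add_sub_ne_zero (K := K) u (a := 16) (b := 9) (by norm_num)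
  have h11 := four_mul_add_sub_ne_zero (K := K) u (a := 16) (b := 11) (by norm_num)
  push_cast at h9 h11
  rw [← hw] at h9 h11
  exact mul_ne_zero (mul_ne_zero (mul_ne_zero (by norm_num) hfactor) h9) h11

theorem eq_inv_smul (hx : SatisfiesRecurrence K e δ x) {u : ℕ} {w : K} (hw : w = 4 * u + 16) :
    x (u + 3) = (16000 * ladderFactor w * (w - 9) * (w - 11))⁻¹ •
      ((200 * (w - 8) * (w - 9) * (w ^ 2 - 15 * w + 38)) • (e * x (u + 2))
        - (5 / 8 * (w - 8) * (w - 12)) • (e ^ 2 * x (u + 1)) + δ * x u) :=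
  (eq_inv_smul_iff₀ (leadingFactor_ne_zero hw)).2 (hx u w hw)

theorem ext (hx : SatisfiesRecurrence K e δ x) (hy : SatisfiesRecurrence K e δ y)
    (h₀ : x 0 = y 0) (h₁ : x 1 = y 1) (h₂ : x 2 = y 2) : ∀ u, x u = y u
  | 0 => h₀
  | 1 => h₁
  | 2 => h₂
  | u + 3 => by
    rw [hx.eq_inv_smul rfl, hy.eq_inv_smul rfl, ext hx hy h₀ h₁ h₂ u, ext hx hy h₀ h₁ h₂ (u + 1),
      ext hx hy h₀ h₁ h₂ (u + 2)]

end SatisfiesRecurrence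

/-- The solution of the three-term recurrence with prescribed initial elements. -/
def recurrenceSequence (K : Type*) {A : Type*} [Field K] [CommRing A] [Algebra K A]
    (e δ x₀ x₁ x₂ : A) : ℕ → A
  | 0 => x₀
  | 1 => x₁
  | 2 => x₂
  | u + 3 =>
    let w : K := 4 * u + 16
    (16000 * ladderFactor w * (w - 9) * (w - 11))⁻¹ •
      ((200 * (w - 8) * (w - 9) * (w ^ 2 - 15 * w + 38)) •
          (e * recurrenceSequence K e δ x₀ x₁ x₂ (u + 2))
        - (5 / 8 * (w - 8) * (w - 12)) • (e ^ 2 * recurrenceSequence K e δ x₀ x₁ x₂ (u + 1))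
        + δ * recurrenceSequence K e δ x₀ x₁ x₂ u)

theorem satisfiesRecurrence_recurrenceSequence {K A : Type*} [Field K] [CharZero K] [CommRing A]
    [Algebra K A] (e δ x₀ x₁ x₂ : A) :
    SatisfiesRecurrence K e δ (recurrenceSequence K e δ x₀ x₁ x₂) := by
  rintro u w rfl
  exact (eq_inv_smul_iff₀ (SatisfiesRecurrence.leadingFactor_ne_zero rfl)).1 rfl

theorem IsRecurrenceSequence.satisfiesRecurrence {f : ℕ → ℍ → ℂ} (hf : IsRecurrenceSequence f) :
    SatisfiesRecurrence ℂ E4 Del fun u => f (4 * u + 8) := by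
  intro u w hw
  have hne := SatisfiesRecurrence.leadingFactor_ne_zero hw
  have hw' : ((4 * u + 16 : ℕ) : ℂ) = w := by rw [hw]; push_cast; rfl
  ext z
  have h := hf.recurrence (4 * u + 16) (by omega) (by omega) z
  rw [hw', show 4 * u + 16 + 4 = 4 * (u + 3) + 8 by ring,
    show 4 * u + 16 - 4 = 4 * (u + 1) + 8 by omega, show 4 * u + 16 - 8 = 4 * u + 8 by omega,
    show 4 * u + 16 = 4 * (u + 2) + 8 by ring] at h
  simp only [ladderFactor, Pi.add_apply, Pi.sub_apply, Pi.smul_apply, Pi.mul_apply, Pi.pow_apply,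
    smul_eq_mul] at hne ⊢
  refine (congrArg _ h).trans ?_
  rw [← mul_assoc, mul_one_div, show (16000 * (w + 2) * (w - 3) * (w - 5) * (w - 9) * (w - 10)
    * (w - 11)) = 16000 * ((w + 2) * (w - 3) * (w - 5) * (w - 10)) * (w - 9) * (w - 11) by ring,
    div_self hne]
  ring

/-- The algebra of holomorphic functions on the upper half-plane. -/
def holomorphicFunctions : Subalgebra ℂ (ℍ → ℂ) where
  carrier := {f | MDiff f}
  mul_mem' hf hg := hf.mul hg
  add_mem' hf hg := hf.add hg
  algebraMap_mem' _ := mdifferentiable_const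

/-- The derivation `dq` of the algebra of holomorphic functions. -/
def dqDerivation : Derivation ℂ holomorphicFunctions holomorphicFunctions :=
  .mk'
    { toFun f := ⟨dq f, Derivative.normalizedDerivOfComplex_mdifferentiable f.2⟩
      map_add' f g := Subtype.ext (Derivative.normalizedDerivOfComplex_add _ _ f.2 g.2)
      map_smul' c f := Subtype.ext (Derivative.normalizedDerivOfComplex_smul c _ f.2) }
    fun f g => Subtype.ext <| by
      refine (Derivative.normalizedDerivOfComplex_mul _ _ f.2 g.2).trans ?_
      simp [mul_comm, add_comm]

/-- The Ramanujan system formed by the Eisenstein series `E₂`, `E₄` and `E₆`. -/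
def eisensteinSystem : RamanujanSystem ℂ holomorphicFunctions where
  D := dqDerivation
  e₂ := ⟨E2, E2_mdifferentiable⟩
  e₄ := ⟨E4, ModularForm.E₄.holo'⟩
  e₆ := ⟨E6, ModularForm.E₆.holo'⟩
  D_e₂ := Subtype.ext dq_E2
  D_e₄ := Subtype.ext dq_E4
  D_e₆ := Subtype.ext dq_E6

theorem coe_disc : (eisensteinSystem.disc : ℍ → ℂ) = Del := Del_eq.symm

theorem satisfiesRecurrence_coe_ladder :
    SatisfiesRecurrence ℂ E4 Del fun u => (eisensteinSystem.ladder u : ℍ → ℂ) :=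
  coe_disc ▸ eisensteinSystem.satisfiesRecurrence_ladder.map holomorphicFunctions.val

theorem IsRecurrenceSequence.eq_ladder {f : ℕ → ℍ → ℂ} (hf : IsRecurrenceSequence f) (u : ℕ) :
    f (4 * u + 8) = eisensteinSystem.ladder u := by
  refine hf.satisfiesRecurrence.ext satisfiesRecurrence_coe_ladder ?_ ?_ ?_ u <;> ext z
  · rw [hf.init8]
    simp [RamanujanSystem.ladder, RamanujanSystem.bottom, eisensteinSystem, mul_assoc]
  · rw [hf.init12, eisensteinSystem.ladder_one]
    simp [eisensteinSystem, mul_assoc, mul_add]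
  · rw [hf.init16, eisensteinSystem.ladder_two]
    simp only [eisensteinSystem, Subalgebra.coe_smul, Subalgebra.coe_add, Subalgebra.coe_sub,
      Subalgebra.coe_mul, Subalgebra.coe_pow, Pi.smul_apply, Pi.add_apply, Pi.sub_apply,
      Pi.mul_apply, Pi.pow_apply, smul_eq_mul]
    ring

/-! ### Vanishing orders and modularity -/

theorem coe_serre (k : ℂ) (f : holomorphicFunctions) :
    (eisensteinSystem.serre k f : ℍ → ℂ) = Derivative.serreDerivative k f :=
  sub_eq_iff_eq_add.2 (dq_eq_serreDerivative_add k f)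

namespace HasLeadingCoeff

variable {f : holomorphicFunctions} {m : ℕ} {c : ℂ}

theorem serre (hf : HasLeadingCoeff f m c) (k : ℂ) :
    HasLeadingCoeff (eisensteinSystem.serre k f) m ((m - k / 12) * c) :=
  coe_serre k f ▸ hf.serreDerivative k

theorem raise (hf : HasLeadingCoeff f m c) (w : ℂ) :
    HasLeadingCoeff (eisensteinSystem.raise w f) m
      ((m - w / 12) * ((m - (w - 2) / 12) * c) - (w - 5) * (w - 6) / 36 * c) :=
  ((hf.serre (w - 2)).serre w).sub ((hasLeadingCoeff_E4.mul_left hf).smul _)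

theorem lower (hf : HasLeadingCoeff f m c) (w : ℂ) :
    HasLeadingCoeff (eisensteinSystem.lower w f) m
      ((m - w / 12) * ((m - (w - 2) / 12) * c) + (w - 7) / 6 * ((m - (w - 2) / 12) * c)
        + (w - 2) * (w - 14) / 144 * c) :=
  ((hasLeadingCoeff_E4.mul_left ((hf.serre (w - 2)).serre w)).add
    ((hasLeadingCoeff_E6.mul_left (hf.serre (w - 2))).smul _)).add
    (((hasLeadingCoeff_E4_pow 2).mul_left hf).smul _)

end HasLeadingCoeff

theorem exists_hasLeadingCoeff_ladder :
    ∀ u : ℕ, ∃ c ≠ 0, HasLeadingCoeff (eisensteinSystem.ladder u) (u + 1) c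
  | 0 => by
    rw [RamanujanSystem.ladder, eisensteinSystem.bottom_eq_D_D]
    exact ⟨_, by norm_num, hasLeadingCoeff_dq_E4.dq.smul (36 / 5)⟩
  | u + 1 => by
    obtain ⟨c, hc, hlead⟩ := exists_hasLeadingCoeff_ladder u
    have hraise : HasLeadingCoeff (eisensteinSystem.raise (4 * u + 8) (eisensteinSystem.ladder u))
        (u + 1) 0 := by
      convert hlead.raise (4 * u + 8) using 1
      push_cast
      ring
    have hvanish : HasLeadingCoeff (eisensteinSystem.ladder (u + 1)) (u + 1) 0 := by
      simpa only [RamanujanSystem.ladder, Subalgebra.coe_smul, mul_zero] using hraise.smul _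
    obtain ⟨d, hd⟩ := hvanish.exists_succ
    have hlower := hd.lower (4 * u + 12)
    rw [eisensteinSystem.lower_ladder] at hlower
    have hDel : HasLeadingCoeff (eisensteinSystem.disc : ℍ → ℂ) 1 1 :=
      coe_disc ▸ hasLeadingCoeff_Del
    have hscaled := (hDel.mul hlead).smul (1 / 10)
    rw [one_mul, add_comm 1] at hscaled
    refine ⟨d, ?_, hd⟩
    rintro rfl
    have hzero := hscaled.unique hlower
    simp [hc] at hzero

namespace SatisfiesRecurrence

variable {x : ℕ → ℍ → ℂ}

theorem isModular (hx : SatisfiesRecurrence ℂ E4 Del x) {k : ℤ} (h₀ : IsModular k (x 0))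
    (h₁ : IsModular (k + 4) (x 1)) (h₂ : IsModular (k + 8) (x 2)) :
    ∀ u : ℕ, IsModular (k + 4 * u) (x u)
  | 0 => by simpa using h₀
  | 1 => by simpa using h₁
  | 2 => by simpa using h₂
  | u + 3 => by
    have hE4 := IsModular.E4.mul (isModular hx h₀ h₁ h₂ (u + 2))
    have hE4sq := (IsModular.E4.pow 2).mul (isModular hx h₀ h₁ h₂ (u + 1))
    have hDel := IsModular.Del.mul (isModular hx h₀ h₁ h₂ u)
    rw [show 4 + (k + 4 * (u + 2 : ℕ)) = k + 4 * (u + 3 : ℕ) by push_cast; ring] at hE4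
    rw [show (2 : ℕ) * 4 + (k + 4 * (u + 1 : ℕ)) = k + 4 * (u + 3 : ℕ) by push_cast; ring] at hE4sq
    rw [show 12 + (k + 4 * (u : ℤ)) = k + 4 * (u + 3 : ℕ) by push_cast; ring] at hDel
    rw [hx.eq_inv_smul rfl]
    exact (((hE4.smul _).sub (hE4sq.smul _)).add hDel).smul _

theorem hasLeadingCoeff (hx : SatisfiesRecurrence ℂ E4 Del x) {t : ℕ → ℂ}
    (ht : SatisfiesRecurrence ℂ 1 0 t) {m : ℕ} (h₀ : HasLeadingCoeff (x 0) m (t 0))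
    (h₁ : HasLeadingCoeff (x 1) m (t 1)) (h₂ : HasLeadingCoeff (x 2) m (t 2)) :
    ∀ u : ℕ, HasLeadingCoeff (x u) m (t u)
  | 0 => h₀
  | 1 => h₁
  | 2 => h₂
  | u + 3 => by
    rw [hx.eq_inv_smul rfl, ht.eq_inv_smul rfl]
    simp only [one_pow, one_mul]
    have hDel : HasLeadingCoeff (Del * x u) m (0 * t u) := by
      simpa using hasLeadingCoeff_Del.of_succ.mul (hasLeadingCoeff hx ht h₀ h₁ h₂ u)
    have hE4 := hasLeadingCoeff_E4.mul_left (hasLeadingCoeff hx ht h₀ h₁ h₂ (u + 2))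
    have hE4sq := (hasLeadingCoeff_E4_pow 2).mul_left (hasLeadingCoeff hx ht h₀ h₁ h₂ (u + 1))
    exact (((hE4.smul _).sub (hE4sq.smul _)).add hDel).smul _

end SatisfiesRecurrence

/-- The common constant term of the three components of `f_w`, `w = 4u + 8`. -/
def constCoeff : ℕ → ℂ
  | 0 => 1
  | u + 1 => (4 * u + 4) / (160 * (4 * u + 10) * (4 * u + 5) * (4 * u + 3)) * constCoeff u

theorem constCoeff_ne_zero (u : ℕ) : constCoeff u ≠ 0 := by
  induction u with
  | zero => exact one_ne_zero
  | succ u ih => refine mul_ne_zero (div_ne_zero ?_ ?_) ih <;> norm_cast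

theorem mul_constCoeff_succ (u : ℕ) :
    160 * (4 * u + 10) * (4 * u + 5) * (4 * u + 3) * constCoeff (u + 1) =
      (4 * u + 4) * constCoeff u := by
  rw [constCoeff, ← mul_assoc, mul_div_cancel₀ _ (by norm_cast)]

theorem satisfiesRecurrence_constCoeff : SatisfiesRecurrence ℂ 1 0 constCoeff := by
  rintro u w rfl
  have h₂ := mul_constCoeff_succ (u + 1)
  have h₃ := mul_constCoeff_succ (u + 2)
  push_cast at h₂ h₃
  simp only [ladderFactor, smul_eq_mul]
  linear_combination 100 * (4 * u + 16 - 10) * (4 * u + 16 - 9) * (4 * u + 16 - 11) * h₃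
    - 5 / 8 * (4 * u + 16 - 12) * h₂

/-- The coefficient of `q` in the `q`-expansion of `g_w`, `w = 4u + 8`. -/
def linearCoeff : ℕ → ℂ
  | 0 => -720
  | 1 => -3 / 25
  | u + 2 => (4 * u + 4) / (160 * (4 * u + 9) * (4 * u + 7) * (4 * u + 2)) * linearCoeff (u + 1)

theorem linearCoeff_ne_zero : ∀ u : ℕ, linearCoeff u ≠ 0
  | 0 => by norm_num [linearCoeff]
  | 1 => by norm_num [linearCoeff]
  | u + 2 => by
    refine mul_ne_zero (div_ne_zero ?_ ?_) (linearCoeff_ne_zero (u + 1)) <;> norm_cast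

theorem mul_linearCoeff_succ (u : ℕ) :
    160 * (4 * u + 9) * (4 * u + 7) * (4 * u + 2) * linearCoeff (u + 2) =
      (4 * u + 4) * linearCoeff (u + 1) := by
  rw [linearCoeff, ← mul_assoc, mul_div_cancel₀ _ (by norm_cast)]

theorem satisfiesRecurrence_linearCoeff : SatisfiesRecurrence ℂ 1 0 linearCoeff := by
  rintro u w rfl
  have h₂ := mul_linearCoeff_succ u
  have h₃ := mul_linearCoeff_succ (u + 1)
  push_cast at h₃
  simp only [ladderFactor, smul_eq_mul]
  linear_combination 100 * (4 * u + 16 + 2) * (4 * u + 16 - 9) * (4 * u + 16 - 11) * h₃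
    - 5 / 8 * (4 * u + 16 - 8) * h₂

/-- The component of `f_w`, `w = 4u + 8`, that is free of `E₂`. -/
def depthZeroPart : ℕ → ℍ → ℂ :=
  recurrenceSequence ℂ E4 Del (E4 ^ 2) ((1 / 6000 : ℂ) • E6 ^ 2)
    ((1 / 2540160000 : ℂ) • ((49 : ℂ) • (E4 * E6 ^ 2) - (25 : ℂ) • E4 ^ 4))

/-- The component of `f_w`, `w = 4u + 8`, that is multiplied by `-2E₂`. -/
def depthOnePart : ℕ → ℍ → ℂ :=
  recurrenceSequence ℂ E4 Del E6 ((1 / 6000 : ℂ) • (E4 * E6))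
    ((24 / 2540160000 : ℂ) • (E4 ^ 2 * E6))

/-- The component of `f_w`, `w = 4u + 8`, that is multiplied by `E₂²`. -/
def depthTwoPart : ℕ → ℍ → ℂ :=
  recurrenceSequence ℂ E4 Del E4 ((1 / 6000 : ℂ) • E4 ^ 2)
    ((1 / 2540160000 : ℂ) • ((49 : ℂ) • E4 ^ 3 - (25 : ℂ) • E6 ^ 2))

theorem satisfiesRecurrence_depthZeroPart : SatisfiesRecurrence ℂ E4 Del depthZeroPart :=
  satisfiesRecurrence_recurrenceSequence _ _ _ _ _

theorem satisfiesRecurrence_depthOnePart : SatisfiesRecurrence ℂ E4 Del depthOnePart :=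
  satisfiesRecurrence_recurrenceSequence _ _ _ _ _

theorem satisfiesRecurrence_depthTwoPart : SatisfiesRecurrence ℂ E4 Del depthTwoPart :=
  satisfiesRecurrence_recurrenceSequence _ _ _ _ _

theorem IsRecurrenceSequence.eq_depthParts {f : ℕ → ℍ → ℂ} (hf : IsRecurrenceSequence f) (u : ℕ) :
    f (4 * u + 8) =
      depthZeroPart u + (-2 : ℂ) • E2 * depthOnePart u + E2 ^ 2 * depthTwoPart u := by
  refine hf.satisfiesRecurrence.ext ((satisfiesRecurrence_depthZeroPart.add
    (satisfiesRecurrence_depthOnePart.mul_left _)).add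
    (satisfiesRecurrence_depthTwoPart.mul_left _)) ?_ ?_ ?_ u <;> ext z
  · rw [hf.init8]
    simp [depthZeroPart, depthOnePart, depthTwoPart, recurrenceSequence, sub_eq_add_neg, mul_assoc]
  · rw [hf.init12]
    simp only [depthZeroPart, depthOnePart, depthTwoPart, recurrenceSequence, Pi.add_apply,
      Pi.mul_apply, Pi.smul_apply, Pi.pow_apply, smul_eq_mul]
    ring
  · rw [hf.init16]
    simp only [depthZeroPart, depthOnePart, depthTwoPart, recurrenceSequence, Pi.add_apply,
      Pi.sub_apply, Pi.mul_apply, Pi.smul_apply, Pi.pow_apply, smul_eq_mul]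
    ring

theorem isModular_depthZeroPart (u : ℕ) : IsModular (8 + 4 * u) (depthZeroPart u) :=
  satisfiesRecurrence_depthZeroPart.isModular (IsModular.E4.pow 2) ((IsModular.E6.pow 2).smul _)
    ((((IsModular.E4.mul (IsModular.E6.pow 2)).smul _).sub ((IsModular.E4.pow 4).smul _)).smul _) u

theorem isModular_depthOnePart (u : ℕ) : IsModular (6 + 4 * u) (depthOnePart u) :=
  satisfiesRecurrence_depthOnePart.isModular .E6 ((IsModular.E4.mul .E6).smul _)
    (((IsModular.E4.pow 2).mul .E6).smul _) u

theorem isModular_depthTwoPart (u : ℕ) : IsModular (4 + 4 * u) (depthTwoPart u) :=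
  satisfiesRecurrence_depthTwoPart.isModular .E4 ((IsModular.E4.pow 2).smul _)
    ((((IsModular.E4.pow 3).smul _).sub ((IsModular.E6.pow 2).smul _)).smul _) u

theorem hasLeadingCoeff_depthZeroPart (u : ℕ) :
    HasLeadingCoeff (depthZeroPart u) 0 (constCoeff u) := by
  refine satisfiesRecurrence_depthZeroPart.hasLeadingCoeff satisfiesRecurrence_constCoeff
    (hasLeadingCoeff_E4_pow 2) ?_ ?_ u
  · convert (hasLeadingCoeff_E6.pow 2).smul (1 / 6000) using 1
    · rfl
    · norm_num [constCoeff]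
  · convert (((hasLeadingCoeff_E4.mul_left (hasLeadingCoeff_E6.pow 2)).smul 49).sub
      ((hasLeadingCoeff_E4_pow 4).smul 25)).smul (1 / 2540160000) using 1
    · rfl
    · norm_num [constCoeff]

theorem hasLeadingCoeff_depthOnePart (u : ℕ) :
    HasLeadingCoeff (depthOnePart u) 0 (constCoeff u) := by
  refine satisfiesRecurrence_depthOnePart.hasLeadingCoeff satisfiesRecurrence_constCoeff
    hasLeadingCoeff_E6 ?_ ?_ u
  · convert (hasLeadingCoeff_E4.mul_left hasLeadingCoeff_E6).smul (1 / 6000) using 1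
    · rfl
    · norm_num [constCoeff]
  · convert ((hasLeadingCoeff_E4_pow 2).mul_left hasLeadingCoeff_E6).smul (24 / 2540160000) using 1
    · rfl
    · norm_num [constCoeff]

theorem hasLeadingCoeff_depthTwoPart (u : ℕ) :
    HasLeadingCoeff (depthTwoPart u) 0 (constCoeff u) := by
  refine satisfiesRecurrence_depthTwoPart.hasLeadingCoeff satisfiesRecurrence_constCoeff
    hasLeadingCoeff_E4 ?_ ?_ u
  · convert (hasLeadingCoeff_E4_pow 2).smul (1 / 6000) using 1
    · rfl
    · norm_num [constCoeff]
  · convert (((hasLeadingCoeff_E4_pow 3).smul 49).sub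
      ((hasLeadingCoeff_E6.pow 2).smul 25)).smul (1 / 2540160000) using 1
    · rfl
    · norm_num [constCoeff]

theorem hasLeadingCoeff_depthOnePart_sub (u : ℕ) :
    HasLeadingCoeff (depthOnePart u + (-1 : ℂ) • E2 * depthTwoPart u) 1 (linearCoeff u) := by
  have hE4 : E6 + (-1 : ℂ) • E2 * E4 = (-3 : ℂ) • dq E4 := by rw [dq_E4]; algebra
  refine (satisfiesRecurrence_depthOnePart.add
    (satisfiesRecurrence_depthTwoPart.mul_left _)).hasLeadingCoeff
    satisfiesRecurrence_linearCoeff ?_ ?_ ?_ u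
  · convert hasLeadingCoeff_dq_E4.smul (-3) using 1
    · exact hE4
    · norm_num [linearCoeff]
  · convert (hasLeadingCoeff_E4.mul_left (hasLeadingCoeff_dq_E4.smul (-3))).smul (1 / 6000) using 1
    · rw [← hE4]
      simp only [depthOnePart, depthTwoPart, recurrenceSequence, Pi.add_apply]
      algebra
    · norm_num [linearCoeff]
  · convert ((((hasLeadingCoeff_E4_pow 2).mul_left (hasLeadingCoeff_dq_E4.smul (-3))).smul 49).add
      ((hasLeadingCoeff_E6.mul_left hasLeadingCoeff_dq_E6).smul 50)).smul (1 / 2540160000) using 1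
    · rw [← hE4, dq_E6]
      simp only [depthOnePart, depthTwoPart, recurrenceSequence, Pi.add_apply]
      algebra
    · norm_num [linearCoeff]

theorem IsModular.isQuasimodular_two {w : ℤ} {F₀ F₁ F₂ : ℍ → ℂ} (h₀ : IsModular w F₀)
    (h₁ : IsModular (w - 2) F₁) (h₂ : IsModular (w - 4) F₂) (hne : F₂ ≠ 0) :
    IsQuasimodular w 2 (F₀ + E2 * F₁ + E2 ^ 2 * F₂) := by
  obtain ⟨G₀, hG₀⟩ : IsModular (w - 2 * (0 : ℕ)) F₀ := by simpa using h₀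
  obtain ⟨G₁, hG₁⟩ : IsModular (w - 2 * (1 : ℕ)) F₁ := by simpa using h₁
  obtain ⟨G₂, hG₂⟩ : IsModular (w - 2 * (2 : ℕ)) F₂ := by simpa using h₂
  refine ⟨fun | 0 => G₀ | 1 => G₁ | 2 => G₂ | _ + 3 => 0, fun hzero => hne ?_, fun z => ?_⟩
  · rw [← hG₂, show G₂ = 0 from hzero, FunLike.coe_zero]
  · simp [Finset.sum_range_succ, hG₀, hG₁, hG₂]

theorem IsRecurrenceSequence.isQuasimodular {f : ℕ → ℍ → ℂ} (hf : IsRecurrenceSequence f) (u : ℕ) :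
    IsQuasimodular (8 + 4 * u) 2 (f (4 * u + 8)) := by
  have h₁ := (isModular_depthOnePart u).smul (-2)
  have h₂ := isModular_depthTwoPart u
  rw [show (6 + 4 * u : ℤ) = 8 + 4 * u - 2 by ring] at h₁
  rw [show (4 + 4 * u : ℤ) = 8 + 4 * u - 4 by ring] at h₂
  rw [hf.eq_depthParts, smul_mul_assoc, ← mul_smul_comm]
  exact (isModular_depthZeroPart u).isQuasimodular_two h₁ h₂
    ((hasLeadingCoeff_depthTwoPart u).ne_zero (constCoeff_ne_zero u))

/-! ### Polynomials in `j` -/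

theorem Del_ne_zero (z : ℍ) : Del z ≠ 0 := ModularForm.discriminant_ne_zero z

theorem hasLeadingCoeff_omega {m : ℕ} (hm : m ≤ 7) (h₁ : m ≠ 1) (h₆ : m ≠ 6) :
    HasLeadingCoeff (omega m) 0 1 := by
  interval_cases m
  · exact .one
  · exact absurd rfl h₁
  · exact hasLeadingCoeff_E4
  · exact hasLeadingCoeff_E6
  · exact hasLeadingCoeff_E4_pow 2
  · exact hasLeadingCoeff_E4.mul_left hasLeadingCoeff_E6
  · exact absurd rfl h₆
  · exact (hasLeadingCoeff_E4_pow 2).mul_left hasLeadingCoeff_E6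

theorem isModular_omega {m : ℕ} (hm : m ≤ 7) (h₁ : m ≠ 1) : IsModular (2 * m) (omega m) := by
  interval_cases m
  · exact .one
  · exact absurd rfl h₁
  · exact .E4
  · exact .E6
  · exact IsModular.E4.pow 2
  · exact IsModular.E4.mul .E6
  · exact .Del
  · exact (IsModular.E4.pow 2).mul .E6

theorem hForm_C_mul_X_pow (n m : ℕ) (c : ℂ) :
    hForm n m (.C c * .X ^ n) = c • (omega m * E4 ^ (3 * n)) := by
  ext z
  have hDel : Del z ^ n ≠ 0 := pow_ne_zero n (Del_ne_zero z)
  simp only [hForm, klein, Polynomial.eval_mul, Polynomial.eval_C, Polynomial.eval_pow,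
    Polynomial.eval_X, div_pow, pow_mul, Pi.smul_apply, Pi.mul_apply, Pi.pow_apply, smul_eq_mul]
  field_simp

theorem hForm_add (n m : ℕ) (P Q : ℂ[X]) : hForm n m (P + Q) = hForm n m P + hForm n m Q := by
  ext z
  simp [hForm, mul_add]

theorem hForm_succ (n m : ℕ) (P : ℂ[X]) : hForm (n + 1) m P = Del * hForm n m P := by
  ext z
  simp only [hForm, Pi.mul_apply]
  ring

theorem hForm_six (n : ℕ) (P : ℂ[X]) : hForm n 6 P = hForm (n + 1) 0 P := by
  ext z
  simp [hForm, omega, pow_succ, mul_assoc]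

theorem hForm_seven (n : ℕ) (P : ℂ[X]) : hForm n 7 P = hForm (n + 1) 1 P := by
  ext z
  have hDel := Del_ne_zero z
  simp only [hForm, omega, Pi.div_apply]
  field_simp
  ring

namespace IsModular

variable {m n : ℕ} {f : ℍ → ℂ} {c : ℂ}

theorem exists_eq_hForm_add_Del_mul (hm : m ≤ 7) (h₁ : m ≠ 1) (h₆ : m ≠ 6)
    (hf : IsModular (12 * n + 2 * m) f) (hc : HasLeadingCoeff f 0 c) :
    ∃ g, IsModular (12 * n + 2 * m - 12) g ∧
      f = hForm n m (.C c * .X ^ n) + QuasimodularRecurrence.Del * g := by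
  have hmod : IsModular (12 * n + 2 * m) (hForm n m (.C c * .X ^ n)) := by
    have h := ((isModular_omega hm h₁).mul (IsModular.E4.pow (3 * n))).smul c
    rw [show (2 * m + (3 * n : ℕ) * 4 : ℤ) = 12 * n + 2 * m by push_cast; ring] at h
    rwa [hForm_C_mul_X_pow]
  have hlead : HasLeadingCoeff (hForm n m (.C c * .X ^ n)) 0 c := by
    simpa only [hForm_C_mul_X_pow, mul_one] using
      ((hasLeadingCoeff_omega hm h₁ h₆).mul_left (hasLeadingCoeff_E4_pow (3 * n))).smul c
  obtain ⟨g, hg, hfg⟩ := (hf.sub hmod).exists_eq_Del_mul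
    (by simpa only [sub_self] using hc.sub hlead)
  exact ⟨g, hg, sub_eq_iff_eq_add'.1 hfg⟩

theorem exists_natDegree_le_eq_hForm (hm : m ≤ 7) (h₁ : m ≠ 1) (h₆ : m ≠ 6)
    (hf : IsModular (12 * n + 2 * m) f) (hc : HasLeadingCoeff f 0 c) :
    ∃ P : ℂ[X], P.natDegree ≤ n ∧ P.coeff n = c ∧ f = hForm n m P := by
  induction n generalizing f c with
  | zero =>
    obtain ⟨g, hg, rfl⟩ := hf.exists_eq_hForm_add_Del_mul hm h₁ h₆ hc
    have hzero : g = 0 := by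
      obtain h | rfl : m ≤ 5 ∨ m = 7 := by omega
      · exact hg.eq_zero_of_neg (by push_cast; omega)
      · exact eq_zero_of_weight_two (by simpa using hg)
    exact ⟨.C c * .X ^ 0, Polynomial.natDegree_C_mul_X_pow_le c 0, by simp, by simp [hzero]⟩
  | succ n ih =>
    obtain ⟨g, hg, rfl⟩ := hf.exists_eq_hForm_add_Del_mul hm h₁ h₆ hc
    rw [show (12 * (n + 1 : ℕ) + 2 * m - 12 : ℤ) = 12 * n + 2 * m by push_cast; ring] at hg
    obtain ⟨d, hd⟩ := hg.exists_hasLeadingCoeff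
    obtain ⟨Q, hQ, -, rfl⟩ := ih hg hd
    refine ⟨.C c * .X ^ (n + 1) + Q, ?_, ?_, ?_⟩
    · exact Polynomial.natDegree_add_le_of_degree_le (Polynomial.natDegree_C_mul_X_pow_le c _)
        (hQ.trans n.le_succ)
    · simp [Polynomial.coeff_eq_zero_of_natDegree_lt (Nat.lt_succ_of_le hQ)]
    · rw [hForm_add, hForm_succ n m Q]

theorem exists_natDegree_eq_eq_hForm (hm : m ≤ 7) (h₁ : m ≠ 1) (h₆ : m ≠ 6)
    (hf : IsModular (12 * n + 2 * m) f) (hc : HasLeadingCoeff f 0 c) (hne : c ≠ 0) :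
    ∃ P : ℂ[X], P.natDegree = n ∧ f = hForm n m P := by
  obtain ⟨P, hdeg, rfl, hP⟩ := hf.exists_natDegree_le_eq_hForm hm h₁ h₆ hc
  exact ⟨P, hdeg.antisymm (Polynomial.le_natDegree_of_ne_zero hne), hP⟩

end IsModular

/-- The degree of the polynomial `P` in the form `Δⁿ ω_m P(j)` of a modular form of weight
`12n + 2m` that does not vanish at `i∞`. For `m = 1` there is no such form with `n = 0`, so the
subtraction never truncates. -/
def polyDegree (n m : ℕ) : ℕ := if m = 1 then n - 1 else if m = 6 then n + 1 else n

theorem IsModular.exists_eq_hForm {m n : ℕ} {f : ℍ → ℂ} {c : ℂ} (hm : m ≤ 7)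
    (hf : IsModular (12 * n + 2 * m) f) (hc : HasLeadingCoeff f 0 c) (hne : c ≠ 0) :
    ∃ P : ℂ[X], P.natDegree = polyDegree n m ∧ f = hForm n m P := by
  by_cases h₁ : m = 1
  · subst h₁
    cases n with
    | zero =>
      exact absurd (eq_zero_of_weight_two (by simpa using hf)) (hc.ne_zero hne)
    | succ n =>
      rw [show (12 * (n + 1 : ℕ) + 2 * (1 : ℕ) : ℤ) = 12 * n + 2 * (7 : ℕ) by push_cast; ring] at hf
      obtain ⟨P, hdeg, rfl⟩ := hf.exists_natDegree_eq_eq_hForm (by simp) (by simp) (by simp) hc hne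
      exact ⟨P, by simpa [polyDegree] using hdeg, hForm_seven n P⟩
  by_cases h₆ : m = 6
  · subst h₆
    rw [show (12 * n + 2 * (6 : ℕ) : ℤ) = 12 * (n + 1 : ℕ) + 2 * (0 : ℕ) by push_cast; ring] at hf
    obtain ⟨P, hdeg, rfl⟩ := hf.exists_natDegree_eq_eq_hForm (by simp) (by simp) (by simp) hc hne
    exact ⟨P, by simpa [polyDegree] using hdeg, (hForm_six n P).symm⟩
  · simpa [polyDegree, h₁, h₆] using hf.exists_natDegree_eq_eq_hForm hm h₁ h₆ hc hne

/-! ### Uniqueness -/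

theorem coeffs_eq_zero_of_three_roots {R : Type*} [CommRing R] [NoZeroDivisors R]
    {a b c x y z : R} (hxy : x ≠ y) (hxz : x ≠ z) (hyz : y ≠ z) (hx : a + x * b + x ^ 2 * c = 0)
    (hy : a + y * b + y ^ 2 * c = 0) (hz : a + z * b + z ^ 2 * c = 0) :
    a = 0 ∧ b = 0 ∧ c = 0 := by
  have hxy' : b + (x + y) * c = 0 := (mul_eq_zero.1
    (by linear_combination hx - hy : (x - y) * _ = 0)).resolve_left (sub_ne_zero.2 hxy)
  have hxz' : b + (x + z) * c = 0 := (mul_eq_zero.1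
    (by linear_combination hx - hz : (x - z) * _ = 0)).resolve_left (sub_ne_zero.2 hxz)
  have hc : c = 0 := (mul_eq_zero.1
    (by linear_combination hxy' - hxz' : (y - z) * _ = 0)).resolve_left (sub_ne_zero.2 hyz)
  have hb : b = 0 := by linear_combination hxy' - (x + y) * hc
  exact ⟨by linear_combination hx - x * hb - x ^ 2 * hc, hb, hc⟩

theorem slash_apply_eq_iff {k : ℤ} {f : ℍ → ℂ} {γ : SL(2, ℤ)} {z : ℍ} {y : ℂ} :
    (f ∣[k] γ) z = y ↔ f (γ • z) = denom γ z ^ k * y := by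
  rw [ModularForm.SL_slash_apply, zpow_neg, ← div_eq_mul_inv,
    div_eq_iff (zpow_ne_zero _ (denom_ne_zero γ z)), mul_comm]

theorem quadratic_E2_slash_apply {k : ℤ} {A B C : ℍ → ℂ} {γ : SL(2, ℤ)} (hA : A ∣[k] γ = A)
    (hB : B ∣[k - 2] γ = B) (hC : C ∣[k - 4] γ = C) (z : ℍ) :
    ((A + E2 * B + E2 ^ 2 * C) ∣[k] γ) z =
      A z + (E2 ∣[(2 : ℤ)] γ) z * B z + (E2 ∣[(2 : ℤ)] γ) z ^ 2 * C z := by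
  have hB' : (E2 * B) ∣[k] γ = (E2 ∣[(2 : ℤ)] γ) * B := by
    rw [← add_sub_cancel 2 k, ModularForm.mul_slash_SL2, hB]
  have hC' : (E2 ^ 2 * C) ∣[k] γ = (E2 ∣[(2 : ℤ)] γ) ^ 2 * C := by
    rw [show k = 2 + 2 + (k - 4) by ring, ModularForm.mul_slash_SL2, pow_two,
      ModularForm.mul_slash_SL2, hC, pow_two]
  simp only [SlashAction.add_slash, hA, hB', hC', Pi.add_apply, Pi.mul_apply, Pi.pow_apply]

theorem eq_zero_of_quadratic_E2_eq_zero {k : ℤ} {A B C : ℍ → ℂ}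
    (hA : ∀ γ : SL(2, ℤ), A ∣[k] γ = A) (hB : ∀ γ : SL(2, ℤ), B ∣[k - 2] γ = B)
    (hC : ∀ γ : SL(2, ℤ), C ∣[k - 4] γ = C) (h : A + E2 * B + E2 ^ 2 * C = 0) :
    A = 0 ∧ B = 0 ∧ C = 0 := by
  suffices hz : ∀ z, A z = 0 ∧ B z = 0 ∧ C z = 0 from
    ⟨funext fun z => (hz z).1, funext fun z => (hz z).2.1, funext fun z => (hz z).2.2⟩
  intro z
  set τ : ℂ := 12 / (2 * Real.pi * Complex.I)
  have hτ₀ : τ ≠ 0 := div_ne_zero (by norm_num) Complex.two_pi_I_ne_zero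
  have hroot (γ : SL(2, ℤ)) : A z + (E2 z + τ * (γ 1 0 / denom γ z)) * B z
      + (E2 z + τ * (γ 1 0 / denom γ z)) ^ 2 * C z = 0 := by
    rw [← E2_slash_apply, ← quadratic_E2_slash_apply (hA γ) (hB γ) (hC γ), h,
      SlashAction.zero_slash, Pi.zero_apply]
  have hz₀ : (z : ℂ) ≠ 0 := z.ne_zero
  have hz₁ : (z : ℂ) + 1 ≠ 0 := by
    simpa [add_comm] using ((1 : ℝ) +ᵥ z).ne_zero
  have hone : A z + E2 z * B z + E2 z ^ 2 * C z = 0 := by simpa using hroot 1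
  have hS : A z + (E2 z + τ / z) * B z + (E2 z + τ / z) ^ 2 * C z = 0 := by
    simpa [ModularGroup.denom_apply, div_eq_mul_inv, show ModularGroup.S 1 0 = 1 by decide,
      show ModularGroup.S 1 1 = 0 by decide] using hroot ModularGroup.S
  have hST : A z + (E2 z + τ / (z + 1)) * B z + (E2 z + τ / (z + 1)) ^ 2 * C z = 0 := by
    have h₁₀ : (ModularGroup.S * ModularGroup.T : SL(2, ℤ)) 1 0 = 1 := by decide
    have h₁₁ : (ModularGroup.S * ModularGroup.T : SL(2, ℤ)) 1 1 = 1 := by decide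
    simpa only [ModularGroup.denom_apply, h₁₀, h₁₁, Int.cast_one, one_mul, mul_one_div] using
      hroot (ModularGroup.S * ModularGroup.T)
  refine coeffs_eq_zero_of_three_roots ?_ ?_ ?_ hone hS hST
  · simp [hτ₀, hz₀]
  · simp [hτ₀, hz₁]
  · simp [div_eq_mul_inv, hτ₀]

theorem klein_smul (γ : SL(2, ℤ)) (z : ℍ) : klein (γ • z) = klein z := by
  have hE4 := slash_apply_eq_iff.1 (congrFun (IsModular.E4.slash_eq γ) z)
  have hDel := slash_apply_eq_iff.1 (congrFun (IsModular.Del.slash_eq γ) z)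
  rw [klein, hE4, hDel, mul_pow, ← zpow_natCast, ← zpow_mul]
  exact mul_div_mul_left _ _ (zpow_ne_zero _ (denom_ne_zero γ z))

theorem omega_smul {m : ℕ} (hm : m ≤ 7) (γ : SL(2, ℤ)) (z : ℍ) :
    omega m (γ • z) = denom γ z ^ (2 * m : ℤ) * omega m z := by
  by_cases h₁ : m = 1
  · subst h₁
    have hω := slash_apply_eq_iff.1 (congrFun ((isModular_omega (m := 7) (by simp)
      (by simp)).slash_eq γ) z)
    have hDel := slash_apply_eq_iff.1 (congrFun (IsModular.Del.slash_eq γ) z)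
    have homega (x : ℍ) : omega 1 x = omega 7 x / Del x := rfl
    rw [homega, homega, hω, hDel, mul_div_mul_comm, ← zpow_sub₀ (denom_ne_zero γ z)]
    norm_num
  · exact slash_apply_eq_iff.1 (congrFun ((isModular_omega hm h₁).slash_eq γ) z)

theorem hForm_slash {n m : ℕ} (hm : m ≤ 7) (P : ℂ[X]) (γ : SL(2, ℤ)) :
    hForm n m P ∣[(12 * n + 2 * m : ℤ)] γ = hForm n m P := by
  ext z
  have hDel := slash_apply_eq_iff.1 (congrFun (IsModular.Del.slash_eq γ) z)
  rw [slash_apply_eq_iff]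
  simp only [hForm, hDel, omega_smul hm, klein_smul]
  rw [zpow_add₀ (denom_ne_zero γ z), zpow_mul _ 12 n, mul_pow, zpow_natCast]
  ring

theorem eventually_omega_ne_zero {m : ℕ} (hm : m ≤ 7) : ∀ᶠ z in atImInfty, omega m z ≠ 0 := by
  filter_upwards [hasLeadingCoeff_E4.eventually_ne_zero one_ne_zero,
    hasLeadingCoeff_E6.eventually_ne_zero one_ne_zero] with z hE4 hE6
  have hDel := Del_ne_zero z
  interval_cases m <;> simp [omega, hE4, hE6, hDel]

theorem eventually_klein_ne (a : ℂ) : ∀ᶠ z in atImInfty, klein z ≠ a := by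
  have hlead := (hasLeadingCoeff_E4_pow 3).sub (hasLeadingCoeff_Del.of_succ.smul a)
  filter_upwards [hlead.eventually_ne_zero (by simp)] with z hz ha
  rw [klein, div_eq_iff (Del_ne_zero z)] at ha
  exact hz (by simp [ha])

theorem eq_zero_of_hForm_eq_zero {n m : ℕ} (hm : m ≤ 7) {P : ℂ[X]} (h : hForm n m P = 0) :
    P = 0 := by
  by_contra hP
  have hroots : ∀ᶠ z in atImInfty, ∀ a ∈ P.roots.toFinset, klein z ≠ a :=
    (eventually_all_finset _).2 fun a _ => eventually_klein_ne a
  obtain ⟨z, hklein, homega⟩ := (hroots.and (eventually_omega_ne_zero hm)).exists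
  have heval : P.eval (klein z) = 0 := by
    simpa [hForm, Del_ne_zero, homega] using congrFun h z
  exact hklein (klein z) (by simpa [hP] using heval) rfl

theorem fForm_eq (n k : ℕ) (P Q R : ℂ[X]) :
    fForm n k P Q R = hForm n (k + 2) P + (-2 : ℂ) • E2 * hForm n (k + 1) Q
      + E2 ^ 2 * hForm n k R := by
  ext z
  simp only [fForm, hForm, Pi.add_apply, Pi.mul_apply, Pi.smul_apply, Pi.pow_apply, smul_eq_mul]
  ring

theorem gForm_eq (n k : ℕ) (Q R : ℂ[X]) :
    gForm n k Q R = hForm n (k + 1) Q + (-1 : ℂ) • E2 * hForm n k R := by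
  ext z
  simp only [gForm, hForm, Pi.add_apply, Pi.mul_apply, Pi.smul_apply, smul_eq_mul]
  ring

theorem fForm_eq_zero {n k : ℕ} (hk : k ≤ 5) {P Q R : ℂ[X]} (h : fForm n k P Q R = 0) :
    P = 0 ∧ Q = 0 ∧ R = 0 := by
  have hB (γ : SL(2, ℤ)) := hForm_slash (n := n) (m := k + 1) (by omega) ((-2 : ℂ) • Q) γ
  have hC (γ : SL(2, ℤ)) := hForm_slash (n := n) (m := k) (by omega) R γ
  rw [show (12 * n + 2 * (k + 1 : ℕ) : ℤ) = 12 * n + 2 * (k + 2 : ℕ) - 2 by push_cast; ring] at hB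
  rw [show (12 * n + 2 * k : ℤ) = 12 * n + 2 * (k + 2 : ℕ) - 4 by push_cast; ring] at hC
  have hsmul : hForm n (k + 1) ((-2 : ℂ) • Q) = (-2 : ℂ) • hForm n (k + 1) Q := by
    ext z
    simp [hForm, mul_left_comm]
  rw [fForm_eq, smul_mul_assoc, ← mul_smul_comm, ← hsmul] at h
  obtain ⟨hP, hQ, hR⟩ := eq_zero_of_quadratic_E2_eq_zero
    (hForm_slash (by omega) P) hB hC h
  refine ⟨eq_zero_of_hForm_eq_zero (by omega) hP, ?_, eq_zero_of_hForm_eq_zero (by omega) hR⟩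
  simpa using eq_zero_of_hForm_eq_zero (by omega) hQ

theorem fForm_inj {n k : ℕ} (hk : k ≤ 5) {P Q R P' Q' R' : ℂ[X]}
    (h : fForm n k P Q R = fForm n k P' Q' R') : P = P' ∧ Q = Q' ∧ R = R' := by
  have hsub : fForm n k (P - P') (Q - Q') (R - R') = 0 := by
    ext z
    have hz := congrFun h z
    simp only [fForm, Polynomial.eval_sub, Pi.zero_apply] at hz ⊢
    linear_combination hz
  simpa only [sub_eq_zero] using fForm_eq_zero hk hsub

/-! ### The sequence `f_w` -/

namespace IsRecurrenceSequence

variable {f : ℕ → ℍ → ℂ}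

theorem apply_eight (hf : IsRecurrenceSequence f) (z : ℍ) : f 8 z = 36 / 5 * dq (dq E4) z :=
  congrFun ((hf.eq_ladder 0).trans (congrArg Subtype.val eisensteinSystem.bottom_eq_D_D)) z

theorem apply_twelve (hf : IsRecurrenceSequence f) (z : ℍ) :
    f 12 z = 1 / 3000 * dq (dq (E4 ^ 2)) z - 4 / 25 * Del z := by
  rw [hf.eq_ladder 1, eisensteinSystem.ladder_one_eq_D_D, ← coe_disc]
  rfl

theorem apply_sixteen (hf : IsRecurrenceSequence f) (z : ℍ) :
    f 16 z = 1 / 2751840000 * dq (dq ((49 : ℂ) • E4 ^ 3 - (25 : ℂ) • E6 ^ 2)) z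
      - 1 / 45500 * (Del z * E4 z) := by
  rw [hf.eq_ladder 2, eisensteinSystem.ladder_two_eq_D_D, ← coe_disc]
  rfl

theorem solvesODE (hf : IsRecurrenceSequence f) (u : ℕ) :
    SolvesODE (4 * u + 8) (f (4 * u + 8)) := by
  intro z
  rw [hf.eq_ladder, mul_assoc]
  exact congrFun (congrArg Subtype.val (eisensteinSystem.solvesSerreODE_ladder u).D_D_D) z

theorem exists_polynomials (hf : IsRecurrenceSequence f) {u n k : ℕ} (hk : k ≤ 5)
    (hu : 4 * u + 8 = 12 * n + 2 * k + 4) :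
    ∃ P Q R : ℂ[X], P.natDegree = degP n k ∧ Q.natDegree = degQ n k ∧ R.natDegree = degR n k ∧
      f (4 * u + 8) = fForm n k P Q R ∧
      HasExactOrder (gForm n k Q R) 1 ∧ HasExactOrder (hForm n k R) 0 := by
  have hzero := isModular_depthZeroPart u
  have hone := isModular_depthOnePart u
  have htwo := isModular_depthTwoPart u
  rw [show (8 + 4 * u : ℤ) = 12 * n + 2 * (k + 2 : ℕ) by omega] at hzero
  rw [show (6 + 4 * u : ℤ) = 12 * n + 2 * (k + 1 : ℕ) by omega] at hone
  rw [show (4 + 4 * u : ℤ) = 12 * n + 2 * k by omega] at htwo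
  have hne := constCoeff_ne_zero u
  have htwo_lead := hasLeadingCoeff_depthTwoPart u
  obtain ⟨P, hP, hzeroP⟩ := hzero.exists_eq_hForm (by omega) (hasLeadingCoeff_depthZeroPart u) hne
  obtain ⟨Q, hQ, honeQ⟩ := hone.exists_eq_hForm (by omega) (hasLeadingCoeff_depthOnePart u) hne
  obtain ⟨R, hR, htwoR⟩ := htwo.exists_eq_hForm (by omega) htwo_lead hne
  refine ⟨P, Q, R, ?_, ?_, ?_, ?_, ?_, ?_⟩
  · simpa [degP, polyDegree] using hP
  · simpa [degQ, polyDegree] using hQ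
  · simpa [degR, polyDegree, show k ≠ 6 by omega] using hR
  · rw [hf.eq_depthParts, hzeroP, honeQ, htwoR, fForm_eq]
  · rw [gForm_eq, ← honeQ, ← htwoR]
    exact (hasLeadingCoeff_depthOnePart_sub u).hasExactOrder (linearCoeff_ne_zero u)
  · exact htwoR ▸ htwo_lead.hasExactOrder hne

theorem hasExactOrder (hf : IsRecurrenceSequence f) (u : ℕ) :
    HasExactOrder (f (4 * u + 8)) (u + 1) := by
  obtain ⟨c, hc, hlead⟩ := exists_hasLeadingCoeff_ladder u
  exact hf.eq_ladder u ▸ hlead.hasExactOrder hc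

end IsRecurrenceSequence

end

end QuasimodularRecurrence

open QuasimodularRecurrence in
theorem proposition5p1 (f : ℕ → ℍ → ℂ) (hf : IsRecurrenceSequence f) :
    -- the closed forms of the initial elements through derivatives
    (∀ z, f 8 z = 36 / 5 * dq (dq E4) z) ∧
    (∀ z, f 12 z = 1 / 3000 * dq (dq (E4 ^ 2)) z - 4 / 25 * Del z) ∧
    (∀ z, f 16 z = 1 / 2751840000 * dq (dq ((49 : ℂ) • E4 ^ 3 - (25 : ℂ) • E6 ^ 2)) z
      - 1 / 45500 * (Del z * E4 z)) ∧
    ∀ w n k : ℕ, 8 ≤ w → 4 ∣ w → k ≤ 5 → w = 12 * n + 2 * k + 4 →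
      IsQuasimodular (w : ℤ) 2 (f w) ∧
      SolvesODE (w : ℂ) (f w) ∧
      ∃ P Q R : Polynomial ℂ,
        -- `f w` is of the prescribed shape, for exactly one choice of the polynomials
        P.natDegree = degP n k ∧ Q.natDegree = degQ n k ∧ R.natDegree = degR n k ∧
        f w = fForm n k P Q R ∧
        (∀ P' Q' R' : Polynomial ℂ, f w = fForm n k P' Q' R' → P' = P ∧ Q' = Q ∧ R' = R) ∧
        -- the exact orders of `f w` and of the corresponding `g` and `h`
        HasExactOrder (f w) (w / 4 - 1) ∧
        HasExactOrder (gForm n k Q R) 1 ∧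
        HasExactOrder (hForm n k R) 0 := by
  refine ⟨hf.apply_eight, hf.apply_twelve, hf.apply_sixteen, fun w n k hw h4 hk hwnk => ?_⟩
  obtain ⟨u, rfl⟩ : ∃ u, w = 4 * u + 8 := ⟨w / 4 - 2, by omega⟩
  obtain ⟨P, Q, R, hP, hQ, hR, hform, hg, hh⟩ := hf.exists_polynomials hk hwnk
  refine ⟨?_, ?_, P, Q, R, hP, hQ, hR, hform, ?_, ?_, hg, hh⟩
  · simpa [add_comm] using hf.isQuasimodular u
  · simpa using hf.solvesODE u
  · exact fun P' Q' R' h => fForm_inj hk (h.symm.trans hform)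
  · simpa [show (4 * u + 8) / 4 - 1 = u + 1 by omega] using hf.hasExactOrder u
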